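/- Let $\omega=e^{2\pi i/3}$, $X|j\rangle=|j+1\bmod 3\rangle$, $Z|j\rangle=\omega^j|j\rangle$, and let $\mathrm{Cl}(n,3)$ be the $n$-qutrit Clifford group, i.e. the normalizer in the unitary group on $(\mathbb C^3)^{\otimes n}$ of the Pauli group generated by $\omega\mathbb 1$ and the operators $X$ and $Z$ on the $n$ qutrits. Put $$|H_3\rangle=\tfrac{1}{\sqrt{3-\sqrt3}}\Big(|0\rangle+\tfrac{\sqrt3-1}{2}(|1\rangle+|2\rangle)\Big),\quad |\mathbb N\rangle=\tfrac1{\sqrt6}(|0\rangle+|1\rangle-2|2\rangle),\quad |\mathbb S\rangle=\tfrac1{\sqrt2}(|1\rangle-|2\rangle).$$ Of two qutrits, qutrit 1 is the data and qutrit 2 the ancilla. Let $H_i$ be the Fourier gate $H=(\omega^{jk}/\sqrt3)_{j,k}$ on qutrit $i$, $S_2$ the gate $\mathrm{diag}(1,1,\omega)$ on qutrit 2, and $\mathrm{SUM}|a,b\rangle=|a,a+b\rangle$. A phase state is a vector $\frac1{\sqrt3}\sum_j e^{i\theta_j}|j\rangle$ with real $\theta_j$. A phase state $|\varphi\rangle$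 is injected by preparing the ancilla in $|\varphi\rangle$, applying $\mathrm{SUM}^\dagger$ to data and ancilla, and measuring the ancilla in the computational basis; on outcome $m$ this applies to the data the gate $G_m(\varphi)=\sqrt3\,(\mathbb 1\otimes\langle m|)\,\mathrm{SUM}^\dagger\,(\mathbb 1\otimes|\varphi\rangle)$. **Theorem.** 1. The circuit $C_{H_3}$ that applies $H_1,\mathrm{SUM},H_1,\mathrm{SUM},H_1,S_2,\mathrm{SUM},H_1,H_2,H_2$ in this order is in $\mathrm{Cl}(2,3)$, and $\langle1|_{\mathrm{anc}}C_{H_3}(|H_3\rangle\otimes|H_3\rangle)=\lambda|\varphi\rangle$ with the phase state $|\varphi\rangle=\frac1{\sqrt3}(|0\rangle+i|1\rangle+e^{i\pi/3}|2\rangle)$ and $|\lambda|^2=3/8$; so the success probability is $3/8$. The injected gate is $G_0(\varphi)=\mathrm{diag}(1,i,e^{i\pi/3})$, and $G_m(\varphi)\notin\mathrm{Cl}(1,3)$ for every $m$. 2. The circuit $C_{\mathbb N}$ that applies $H_1,H_2,\mathrm{SUM},H_1^\dagger,H_2,\mathrm{SUM},H_1$ in this order is in $\mathrm{Cl}(2,3)$,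 and $\langle0|_{\mathrm{anc}}C_{\mathbb N}(|\mathbb N\rangle\otimes|\mathbb N\rangle)=\mu|\varphi\rangle$ with the phase state $|\varphi\rangle=\frac1{\sqrt3}(|0\rangle-|1\rangle-|2\rangle)$ and $|\mu|^2=1/4$; so the success probability is $1/4$. The injected gate is $G_0(\varphi)=\mathrm{diag}(1,-1,-1)$, and $G_m(\varphi)\notin\mathrm{Cl}(1,3)$ for every $m$. 3. For every $C\in\mathrm{Cl}(2,3)$ and every outcome $k$: if $\langle k|_{\mathrm{anc}}C(|\mathbb S\rangle\otimes|\mathbb S\rangle)$ is a nonzero multiple of a phase state $|\varphi\rangle$, then $G_m(\varphi)\in\mathrm{Cl}(1,3)$ for every $m$. -/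

import Mathlib

open scoped Matrix Kronecker

noncomputable section

namespace Qutrit

/-- The basis labels `0, 1, 2` of a qutrit; addition of labels is addition modulo `3`. -/
abbrev Lbl : Type := Fin 3

/-- State vectors of one qutrit, in the computational basis. -/
abbrev Ket : Type := Lbl → ℂ

/-- Operators on one qutrit. -/
abbrev Op : Type := Matrix Lbl Lbl ℂ

/-- Operators on two qutrits. A basis label is a pair `(a, b)`: `a` belongs to qutrit 1 (the data),
`b` to qutrit 2 (the ancilla). -/
abbrev Op₂ : Type := Matrix (Lbl × Lbl) (Lbl × Lbl) ℂ

/-- `ω = exp (2 π i / 3)`. -/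
def ω : ℂ := Complex.exp (2 * Real.pi * Complex.I / 3)

/-! ### Pauli and Clifford groups -/

/-- The shift `X |j⟩ = |j + 1⟩`. -/
def X : Op := Matrix.of fun i j => if i = j + 1 then 1 else 0

/-- The clock `Z |j⟩ = ω ^ j |j⟩`. -/
def Z : Op := Matrix.diagonal fun j => ω ^ j.val

/-- The one-qutrit Pauli (Heisenberg–Weyl) group: all `ω ^ c X ^ a Z ^ b`. -/
def pauli₁ : Set Op := {P | ∃ c a b : Lbl, P = ω ^ c.val • (X ^ a.val * Z ^ b.val)}

/-- The two-qutrit Pauli (Heisenberg–Weyl) group: all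
`ω ^ c (X ^ a Z ^ b) ⊗ (X ^ a' Z ^ b')`. -/
def pauli₂ : Set Op₂ :=
  {P | ∃ c a b a' b' : Lbl,
    P = ω ^ c.val • ((X ^ a.val * Z ^ b.val) ⊗ₖ (X ^ a'.val * Z ^ b'.val))}

/-- The normalizer of a set `G` of matrices in the unitary group: the unitary matrices `U` with
`U G U† = G`. -/
def unitaryNormalizer {n : Type} [Fintype n] [DecidableEq n] (G : Set (Matrix n n ℂ)) :
    Set (Matrix n n ℂ) :=
  {U | U ∈ Matrix.unitaryGroup n ℂ ∧ (fun P => U * P * Uᴴ) '' G = G}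

/-- The one-qutrit Clifford group (global phases included). -/
def clifford₁ : Set Op := unitaryNormalizer pauli₁

/-- The two-qutrit Clifford group (global phases included). -/
def clifford₂ : Set Op₂ := unitaryNormalizer pauli₂

/-! ### Gates -/

/-- The qutrit Hadamard gate (Fourier transform), with entries `ω ^ (j k) / √3`. -/
def had : Op := Matrix.of fun j k => ω ^ (j.val * k.val) / (Real.sqrt 3 : ℂ)

/-- The phase gate `diag (1, 1, ω)`. -/
def phaseGate : Op := Matrix.diagonal ![1, 1, ω]

/-- `H` on qutrit 1. -/
def H₁ : Op₂ := had ⊗ₖ (1 : Op)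

/-- `H` on qutrit 2. -/
def H₂ : Op₂ := (1 : Op) ⊗ₖ had

/-- The phase gate on qutrit 2. -/
def S₂ : Op₂ := (1 : Op) ⊗ₖ phaseGate

/-- `SUM |a, b⟩ = |a, b + a⟩`: control on qutrit 1, target on qutrit 2. -/
def SUM : Op₂ := Matrix.of fun p q => if p = (q.1, q.2 + q.1) then 1 else 0

/-- The circuit `H₁, SUM, H₁, SUM, H₁, S₂, SUM, H₁, H₂, H₂`, the first listed gate being applied
first (so that it is the rightmost factor of the matrix product). -/
def circuitH3 : Op₂ := H₂ * H₂ * H₁ * SUM * S₂ * H₁ * SUM * H₁ * SUM * H₁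

/-- The circuit `H₁, H₂, SUM, H₁†, H₂, SUM, H₁`, the first listed gate being applied first. -/
def circuitN : Op₂ := H₁ * SUM * H₂ * H₁ᴴ * SUM * H₂ * H₁

/-! ### Magic states -/

/-- The Hadamard eigenstate `(|0⟩ + ((√3 - 1) / 2) (|1⟩ + |2⟩)) / √(3 - √3)`. -/
def ketH3 : Ket := fun j =>
  (![1, ((Real.sqrt 3 - 1) / 2 : ℝ), ((Real.sqrt 3 - 1) / 2 : ℝ)] j : ℂ)
    / (Real.sqrt (3 - Real.sqrt 3) : ℂ)

/-- The Norrell state `(|0⟩ + |1⟩ - 2 |2⟩) / √6`. -/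
def ketN : Ket := fun j => (![1, 1, -2] j : ℂ) / (Real.sqrt 6 : ℂ)

/-- The Strange state `(|1⟩ - |2⟩) / √2`. -/
def ketS : Ket := fun j => (![0, 1, -1] j : ℂ) / (Real.sqrt 2 : ℂ)

/-! ### Measurement branches, phase states, injection -/

/-- `(1 ⊗ ⟨k|) C (|φ⟩ ⊗ |ψ⟩)`: prepare the data in `φ` and the ancilla in `ψ`, apply `C`, and
project the ancilla on the outcome `k`. The result is not normalized. -/
def branchOutput (C : Op₂) (φ ψ : Ket) (k : Lbl) : Ket :=
  fun i => (C *ᵥ fun p => φ p.1 * ψ p.2) (i, k)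

/-- `⟨k|_anc C (|M⟩ ⊗ |M⟩)`. -/
def twoCopyOutput (C : Op₂) (M : Ket) (k : Lbl) : Ket := branchOutput C M M k

/-- The probability of the outcome `k` when `C` is applied to `|M⟩ ⊗ |M⟩` and qutrit 2 is
measured in the computational basis. -/
def successProb (C : Op₂) (M : Ket) (k : Lbl) : ℝ := ∑ i, ‖twoCopyOutput C M k i‖ ^ 2

/-- The operator `(1 ⊗ ⟨k|) C (1 ⊗ |ψ⟩)` that branch `k` implements on the data; its `j`-th column
is the output for the data basis state `|j⟩`. -/
def branchOperator (C : Op₂) (ψ : Ket) (k : Lbl) : Op :=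
  Matrix.of fun i j => branchOutput C (Pi.single j 1) ψ k i

/-- Phase states `(1 / √3) ∑ⱼ exp (i θⱼ) |j⟩` with real `θⱼ`. -/
def IsPhaseState (φ : Ket) : Prop :=
  ∃ θ : Lbl → ℝ, φ = fun j => Complex.exp (θ j * Complex.I) / (Real.sqrt 3 : ℂ)

/-- The gate that the standard single-shot injection gadget applies to the data on outcome `m`:
the data controls `SUM†`, `|a, b⟩ ↦ |a, b - a⟩`, on an ancilla in the phase state `φ`, and the
ancilla is then measured, with outcome `m`. The factor `√3` normalizes the branch operator: each
outcome has probability `1 / 3`. -/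
def injectedGate (φ : Ket) (m : Lbl) : Op := (Real.sqrt 3 : ℂ) • branchOperator SUMᴴ φ m

end Qutrit

end

open Qutrit

noncomputable section

namespace Qutrit

/-! ### The additive character of the labels -/

/-! Injection of a phase state gives a diagonal gate whose entries are the rescaled amplitudes,
cyclically shifted by the outcome. A diagonal unitary is Clifford exactly when the cubes of its
entries agree, so everything reduces to the cubes of the amplitudes
(`injectedGate_mem_clifford₁_iff`). For the first two states the circuits are products of Clifford
generators, the outputs are computed exactly in terms of `ω` and `√3`, and the cubes differ: `I ^ 3
≠ 1` and `(-1) ^ 3 ≠ 1`.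

For the Strange state no enumeration of circuits is needed. Its Weyl expectation values are `1` at
the origin of phase space and `-1/2` at every other point. Pulling the ancilla clock back through
the circuit gives a Weyl operator at a point `v`; a branch expectation value is then, up to a
factor, a phase-weighted sum of two-copy values along a line `u + c • v` (`dotProduct_branch`). A
phase state has vanishing clock expectation, so such a sum vanishes for the pulled-back data clock.
Since the branch itself is nonzero, `projectedValue_zero_eq_zero_or` leaves only one case: a
nontrivial weight and a `v` with both components nonzero. In that case the sums at `0` and at `(v.1,
-v.2)` are equal, so a data Weyl operator has an expectation value of full modulus and the output is
its eigenvector. This operator is not the identity, and an eigenvector of such a Weyl operator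
without zero entries has amplitudes with equal cubes (`cube_eq_of_weyl_mulVec_eq`). -/

theorem ω_eq : ω = -1 / 2 + (Real.sqrt 3 : ℂ) / 2 * Complex.I := by
  have h : (2 * Real.pi * Complex.I / 3 : ℂ) = ((2 * Real.pi / 3 : ℝ) : ℂ) * Complex.I := by
    push_cast; ring
  have h2 : 2 * Real.pi / 3 = Real.pi - Real.pi / 3 := by ring
  rw [ω, h, Complex.exp_mul_I, ← Complex.ofReal_cos, ← Complex.ofReal_sin, h2, Real.cos_pi_sub,
    Real.sin_pi_sub, Real.cos_pi_div_three, Real.sin_pi_div_three]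
  push_cast; ring

theorem sqrt_three_sq : (Real.sqrt 3 : ℂ) ^ 2 = 3 := by
  rw [← Complex.ofReal_pow, Real.sq_sqrt (by norm_num)]; norm_num

theorem sqrt_three_ne_zero : (Real.sqrt 3 : ℂ) ≠ 0 := by
  intro h; have := sqrt_three_sq; simp [h] at this

theorem ω_sum : ω ^ 2 + ω + 1 = 0 := by
  rw [ω_eq]
  linear_combination (Complex.I ^ 2 / 4) * sqrt_three_sq + (3 / 4) * Complex.I_sq

theorem ω_cube : ω ^ 3 = 1 := by
  linear_combination (ω - 1) * ω_sum

theorem ω_ne_one : ω ≠ 1 := by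
  intro h; have := ω_sum; rw [h] at this; norm_num at this

theorem star_ω : star ω = ω ^ 2 := by
  have h : star ω = -1 / 2 - (Real.sqrt 3 : ℂ) / 2 * Complex.I := by
    rw [ω_eq]; simp [Complex.conj_ofReal]; ring
  rw [h]; linear_combination -ω_sum + ω_eq

/-- The additive character `x ↦ ω ^ x`. -/
def chi (x : Lbl) : ℂ := ω ^ x.val

@[simp] theorem chi_zero : chi 0 = 1 := by simp [chi]

theorem chi_one : chi 1 = ω := by simp [chi]

theorem chi_two : chi 2 = ω ^ 2 := by simp [chi]

theorem ω_pow_mod (n : ℕ) : ω ^ (n % 3) = ω ^ n := by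
  conv_rhs => rw [← Nat.mod_add_div n 3, pow_add, pow_mul, ω_cube, one_pow, mul_one]

theorem chi_add (x y : Lbl) : chi (x + y) = chi x * chi y := by
  rw [chi, Fin.val_add, ω_pow_mod, pow_add]; rfl

theorem chi_mul (x y : Lbl) : chi (x * y) = ω ^ (x.val * y.val) := by
  rw [chi, Fin.val_mul, ω_pow_mod]

theorem chi_neg_mul_self (x : Lbl) : chi (-x) * chi x = 1 := by
  rw [← chi_add]; simp

theorem chi_ne_zero (x : Lbl) : chi x ≠ 0 := right_ne_zero_of_mul_eq_one (chi_neg_mul_self x)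

theorem star_chi (x : Lbl) : star (chi x) = chi (-x) := by
  fin_cases x
  · simp
  · change star (chi 1) = chi 2
    rw [chi_one, chi_two, star_ω]
  · change star (chi 2) = chi 1
    rw [chi_one, chi_two, star_pow, star_ω]
    linear_combination ω * ω_cube

theorem chi_cube (x : Lbl) : chi x ^ 3 = 1 := by
  rw [chi, ← pow_mul, mul_comm, pow_mul, ω_cube, one_pow]

theorem exists_chi_of_cube_eq_one {z : ℂ} (hz : z ^ 3 = 1) : ∃ x, z = chi x := by
  have h : (z - 1) * ((z - ω) * (z - ω ^ 2)) = 0 := by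
    linear_combination hz + (-z ^ 2 + ω * z - ω + 1) * ω_sum
  rcases mul_eq_zero.1 h with h | h
  · exact ⟨0, by rw [chi_zero]; linear_combination h⟩
  rcases mul_eq_zero.1 h with h | h
  · exact ⟨1, by rw [chi_one]; linear_combination h⟩
  · exact ⟨2, by rw [chi_two]; linear_combination h⟩

theorem chi_eq_one_iff (x : Lbl) : chi x = 1 ↔ x = 0 := by
  refine ⟨fun h => ?_, fun h => by rw [h, chi_zero]⟩
  fin_cases x
  · rfl
  · exact absurd (chi_one.symm.trans h) ω_ne_one
  · refine absurd ?_ ω_ne_one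
    have h2 : ω ^ 2 = 1 := chi_two.symm.trans h
    linear_combination ω_cube - ω * h2

theorem chi_sub_mul (x y : Lbl) : chi (x - y) * chi y = chi x := by
  rw [← chi_add]; simp

theorem norm_chi (x : Lbl) : ‖chi x‖ = 1 := by
  have h := congrArg norm (chi_cube x)
  rw [norm_pow, norm_one] at h
  exact (pow_eq_one_iff_of_nonneg (norm_nonneg _) (by norm_num)).1 h

/-! ### Weyl operators -/

open Fin.CommRing

/-- The operator `X ^ a Z ^ b`. -/
def weyl (a b : Lbl) : Op := Matrix.of fun i j => if i = j + a then chi (b * j) else 0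

theorem weyl_apply (a b i j : Lbl) : weyl a b i j = if i = j + a then chi (b * j) else 0 := rfl

theorem weyl_mul (a b a' b' : Lbl) :
    weyl a b * weyl a' b' = chi (b * a') • weyl (a + a') (b + b') := by
  ext i j
  simp only [Matrix.mul_apply, weyl_apply, Matrix.smul_apply, smul_eq_mul, ite_mul, zero_mul,
    mul_ite, mul_zero, Finset.sum_ite_eq', Finset.mem_univ, if_true]
  have h : j + a' + a = j + (a + a') := by ring
  simp only [h, ← chi_add]
  congr 2; ring

theorem weyl_zero : weyl 0 0 = 1 := by
  ext i j; simp [weyl_apply, Matrix.one_apply]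

theorem X_pow (a : Lbl) : X ^ a.val = weyl a 0 := by
  have h : X = weyl 1 0 := by ext i j; simp [X, weyl_apply]
  fin_cases a
  · simp [weyl_zero]
  · simp [h]
  · change X ^ 2 = weyl 2 0
    rw [pow_two, h, weyl_mul]; simp

theorem Z_pow (b : Lbl) : Z ^ b.val = weyl 0 b := by
  have h : Z = weyl 0 1 := by
    ext i j
    by_cases hij : i = j
    · subst hij; simp [Z, weyl_apply, chi]
    · simp [Z, weyl_apply, hij]
  fin_cases b
  · simp [weyl_zero]
  · simp [h]
  · change Z ^ 2 = weyl 0 2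
    rw [pow_two, h, weyl_mul]; simp

theorem X_pow_mul_Z_pow (a b : Lbl) : X ^ a.val * Z ^ b.val = weyl a b := by
  rw [X_pow, Z_pow, weyl_mul]; simp

theorem mem_pauli₁ {P : Op} : P ∈ pauli₁ ↔ ∃ c a b, P = chi c • weyl a b := by
  simp only [pauli₁, X_pow_mul_Z_pow]; rfl

theorem mem_pauli₂ {P : Op₂} :
    P ∈ pauli₂ ↔ ∃ c a b a' b', P = chi c • (weyl a b ⊗ₖ weyl a' b') := by
  simp only [pauli₂, X_pow_mul_Z_pow]; rfl

/-! ### Membership in the Clifford groups -/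

theorem finite_pauli₁ : pauli₁.Finite := by
  have : pauli₁ = Set.range fun p : Lbl × Lbl × Lbl => chi p.1 • weyl p.2.1 p.2.2 := by
    ext P; simp [mem_pauli₁, eq_comm]
  rw [this]; exact Set.finite_range _

theorem finite_pauli₂ : pauli₂.Finite := by
  have : pauli₂ = Set.range fun p : Lbl × Lbl × Lbl × Lbl × Lbl =>
      chi p.1 • (weyl p.2.1 p.2.2.1 ⊗ₖ weyl p.2.2.2.1 p.2.2.2.2) := by
    ext P; simp [mem_pauli₂, eq_comm]
  rw [this]; exact Set.finite_range _

section Normalizer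

variable {n : Type} [Fintype n] [DecidableEq n] {G : Set (Matrix n n ℂ)} {U V : Matrix n n ℂ}

/-- Conjugation is injective, so on a finite set mapping into the set already means mapping onto it.
-/
theorem mem_unitaryNormalizer_of_finite (hG : G.Finite) (hU : U ∈ Matrix.unitaryGroup n ℂ)
    (h : ∀ P ∈ G, U * P * Uᴴ ∈ G) : U ∈ unitaryNormalizer G := by
  refine ⟨hU, ?_⟩
  have hinj : Function.Injective fun P => U * P * Uᴴ := by
    have h1 : Uᴴ * U = 1 := (Matrix.mem_unitaryGroup_iff' (A := U)).1 hU
    intro P Q hPQ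
    have hPQ : U * P * Uᴴ = U * Q * Uᴴ := hPQ
    calc P = (Uᴴ * U) * P * (Uᴴ * U) := by simp [h1]
      _ = Uᴴ * (U * P * Uᴴ) * U := by simp only [Matrix.mul_assoc]
      _ = Uᴴ * (U * Q * Uᴴ) * U := by rw [hPQ]
      _ = (Uᴴ * U) * Q * (Uᴴ * U) := by simp only [Matrix.mul_assoc]
      _ = Q := by simp [h1]
  refine Set.eq_of_subset_of_ncard_le (Set.image_subset_iff.2 h) ?_ hG
  rw [Set.ncard_image_of_injective _ hinj]

theorem conj_mem_of_mem_unitaryNormalizer (hU : U ∈ unitaryNormalizer G) {P} (hP : P ∈ G) :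
    U * P * Uᴴ ∈ G := by
  rw [← hU.2]; exact ⟨P, hP, rfl⟩

theorem conjTranspose_mul_self_of_mem (hU : U ∈ unitaryNormalizer G) : Uᴴ * U = 1 :=
  (Matrix.mem_unitaryGroup_iff' (A := U)).1 hU.1

theorem mul_conjTranspose_self_of_mem (hU : U ∈ unitaryNormalizer G) : U * Uᴴ = 1 :=
  (Matrix.mem_unitaryGroup_iff (A := U)).1 hU.1

theorem conj_symm_mem_of_mem_unitaryNormalizer (hU : U ∈ unitaryNormalizer G) {P} (hP : P ∈ G) :
    Uᴴ * P * U ∈ G := by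
  rw [← hU.2] at hP
  obtain ⟨Q, hQ, rfl⟩ := hP
  have h1 := conjTranspose_mul_self_of_mem hU
  have : Uᴴ * (U * Q * Uᴴ) * U = (Uᴴ * U) * Q * (Uᴴ * U) := by simp only [Matrix.mul_assoc]
  simpa [this, h1] using hQ

theorem mul_mem_unitaryNormalizer (hU : U ∈ unitaryNormalizer G) (hV : V ∈ unitaryNormalizer G) :
    U * V ∈ unitaryNormalizer G := by
  refine ⟨mul_mem hU.1 hV.1, ?_⟩
  have : (fun P => U * V * P * (U * V)ᴴ) = (fun P => U * P * Uᴴ) ∘ fun P => V * P * Vᴴ := by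
    ext1 P; simp only [Function.comp, Matrix.conjTranspose_mul, Matrix.mul_assoc]
  rw [this, Set.image_comp, hV.2, hU.2]

theorem conjTranspose_mem_unitaryNormalizer (hG : G.Finite) (hU : U ∈ unitaryNormalizer G) :
    Uᴴ ∈ unitaryNormalizer G := by
  refine mem_unitaryNormalizer_of_finite hG (Unitary.star_mem hU.1) fun P hP => ?_
  rw [Matrix.conjTranspose_conjTranspose]
  exact conj_symm_mem_of_mem_unitaryNormalizer hU hP

end Normalizer

theorem one_mem_clifford₁ : (1 : Op) ∈ clifford₁ :=
  mem_unitaryNormalizer_of_finite finite_pauli₁ (one_mem _) fun P hP => by simpa using hP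

theorem kronecker_mem_clifford₂ {U V : Op} (hU : U ∈ clifford₁) (hV : V ∈ clifford₁) :
    U ⊗ₖ V ∈ clifford₂ := by
  refine mem_unitaryNormalizer_of_finite finite_pauli₂ ?_ fun P hP => ?_
  · rw [Matrix.mem_unitaryGroup_iff, Matrix.star_eq_conjTranspose,
      Matrix.conjTranspose_kronecker,
      ← Matrix.mul_kronecker_mul, mul_conjTranspose_self_of_mem hU,
      mul_conjTranspose_self_of_mem hV, Matrix.one_kronecker_one]
  · obtain ⟨c, a, b, a', b', rfl⟩ := mem_pauli₂.1 hP
    obtain ⟨c₁, a₁, b₁, h₁⟩ := mem_pauli₁.1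
      (conj_mem_of_mem_unitaryNormalizer hU (mem_pauli₁.2 ⟨0, a, b, rfl⟩))
    obtain ⟨c₂, a₂, b₂, h₂⟩ := mem_pauli₁.1
      (conj_mem_of_mem_unitaryNormalizer hV (mem_pauli₁.2 ⟨0, a', b', rfl⟩))
    rw [chi_zero, one_smul] at h₁ h₂
    refine mem_pauli₂.2 ⟨c + (c₁ + c₂), a₁, b₁, a₂, b₂, ?_⟩
    rw [Matrix.mul_smul, Matrix.smul_mul, Matrix.conjTranspose_kronecker,
      ← Matrix.mul_kronecker_mul,
      ← Matrix.mul_kronecker_mul, h₁, h₂, Matrix.smul_kronecker, Matrix.kronecker_smul, smul_smul,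
      smul_smul, chi_add, chi_add, mul_assoc]

/-! ### The Fourier and `SUM` gates are Clifford -/

theorem sum_lbl {M : Type*} [AddCommMonoid M] (f : Lbl → M) : ∑ i, f i = f 0 + f 1 + f 2 :=
  Fin.sum_univ_three f

theorem sum_chi_mul (x : Lbl) : ∑ k, chi (x * k) = if x = 0 then 3 else 0 := by
  fin_cases x
  · simp
  · simp only [sum_lbl]
    change chi 0 + chi 1 + chi 2 = 0
    rw [chi_zero, chi_one, chi_two]; linear_combination ω_sum
  · simp only [sum_lbl]
    change chi 0 + chi 2 + chi 1 = 0
    rw [chi_zero, chi_one, chi_two]; linear_combination ω_sum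

theorem had_apply (i j : Lbl) : had i j = chi (i * j) / (Real.sqrt 3 : ℂ) := by
  rw [chi_mul]; rfl

theorem had_mul_conjTranspose : had * hadᴴ = 1 := by
  ext i j
  have h : ∀ k, had i k * hadᴴ k j = chi ((i - j) * k) / 3 := by
    intro k
    rw [Matrix.conjTranspose_apply, had_apply, had_apply, star_div₀, star_chi, Complex.star_def,
      Complex.conj_ofReal, div_mul_div_comm, ← chi_add, ← pow_two, sqrt_three_sq]
    congr 2; ring
  rw [Matrix.mul_apply, Finset.sum_congr rfl fun k _ => h k, ← Finset.sum_div, sum_chi_mul,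
    Matrix.one_apply]
  by_cases hij : i = j
  · simp [hij]
  · simp [hij, sub_eq_zero]

theorem had_mul_weyl (a b : Lbl) : had * weyl a b = chi (-(a * b)) • (weyl (-b) a * had) := by
  ext i j
  rw [Matrix.smul_apply, Matrix.mul_apply, Matrix.mul_apply, Finset.sum_eq_single (j + a),
    Finset.sum_eq_single (i + b)]
  · simp only [had_apply, weyl_apply, add_neg_cancel_right, if_true,
      smul_eq_mul]
    rw [div_mul_eq_mul_div, ← chi_add, ← mul_div_assoc, ← mul_div_assoc, ← chi_add, ← chi_add]
    congr 2; ring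
  · intro k _ hk
    rw [weyl_apply, if_neg, zero_mul]
    rintro rfl; apply hk; ring
  · simp
  · intro k _ hk; simp [weyl_apply, hk]
  · simp

theorem had_mem_clifford₁ : had ∈ clifford₁ := by
  refine mem_unitaryNormalizer_of_finite finite_pauli₁
    (Matrix.mem_unitaryGroup_iff.2 had_mul_conjTranspose) fun P hP => ?_
  obtain ⟨c, a, b, rfl⟩ := mem_pauli₁.1 hP
  refine mem_pauli₁.2 ⟨c + -(a * b), -b, a, ?_⟩
  rw [Matrix.mul_smul, had_mul_weyl, smul_smul, Matrix.smul_mul, Matrix.mul_assoc,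
    had_mul_conjTranspose, mul_one, chi_add]

theorem SUM_apply (p q : Lbl × Lbl) : SUM p q = if p = (q.1, q.2 + q.1) then 1 else 0 := rfl

theorem SUM_mul_conjTranspose : SUM * SUMᴴ = 1 := by
  ext p q
  rw [Matrix.mul_apply, Finset.sum_eq_single (p.1, p.2 - p.1)]
  · rw [Matrix.conjTranspose_apply, SUM_apply, SUM_apply, Matrix.one_apply]
    simp [eq_comm]
  · intro k _ hk
    rw [SUM_apply, if_neg, zero_mul]
    rintro rfl; apply hk; simp
  · simp

theorem SUM_mul_weyl (a b a' b' : Lbl) :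
    SUM * (weyl a b ⊗ₖ weyl a' b') = (weyl a (b - b') ⊗ₖ weyl (a' + a) b') * SUM := by
  ext ⟨i, k⟩ ⟨j, l⟩
  rw [Matrix.mul_apply, Matrix.mul_apply, Finset.sum_eq_single (j + a, l + a'),
    Finset.sum_eq_single (j, l + j)]
  · simp only [SUM_apply, Matrix.kroneckerMap_apply, weyl_apply, if_true, Prod.mk.injEq, one_mul,
      mul_one, ite_mul, mul_ite, mul_zero, zero_mul, ← chi_add]
    have h1 : l + a' + (j + a) = l + j + (a' + a) := by ring
    have h2 : b * j + b' * l = (b - b') * j + b' * (l + j) := by ring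
    rw [h1, h2]
    by_cases hi : i = j + a <;> by_cases hk : k = l + j + (a' + a) <;> simp [hi, hk]
  · rintro ⟨x, y⟩ _ h
    rw [SUM_apply, if_neg, mul_zero]
    exact h
  · simp
  · rintro ⟨x, y⟩ _ h
    have : (weyl a b ⊗ₖ weyl a' b') (x, y) (j, l) = 0 := by
      simp only [Matrix.kroneckerMap_apply, weyl_apply]
      by_cases h1 : x = j + a
      · rw [if_neg (c := y = l + a'), mul_zero]
        rintro rfl; exact h (by rw [h1])
      · rw [if_neg h1, zero_mul]
    rw [this, mul_zero]
  · simp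

theorem SUM_mem_clifford₂ : SUM ∈ clifford₂ := by
  refine mem_unitaryNormalizer_of_finite finite_pauli₂
    (Matrix.mem_unitaryGroup_iff.2 SUM_mul_conjTranspose) fun P hP => ?_
  obtain ⟨c, a, b, a', b', rfl⟩ := mem_pauli₂.1 hP
  refine mem_pauli₂.2 ⟨c, a, b - b', a' + a, b', ?_⟩
  rw [Matrix.mul_smul, SUM_mul_weyl, Matrix.smul_mul, Matrix.mul_assoc, SUM_mul_conjTranspose,
    mul_one]

/-! ### Diagonal Clifford gates and injected gates -/

theorem diagonal_conj_apply (d : Ket) (A : Op) (i j : Lbl) :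
    (Matrix.diagonal d * A * (Matrix.diagonal d)ᴴ) i j = d i * A i j * star (d j) := by
  rw [Matrix.diagonal_conjTranspose, Matrix.mul_diagonal, Matrix.diagonal_mul]; rfl

theorem mul_star_of_norm_eq_one {z : ℂ} (h : ‖z‖ = 1) : z * star z = 1 := by
  rw [Complex.star_def, Complex.mul_conj, Complex.normSq_eq_norm_sq, h]; norm_num

/-- Every function on the field with three elements is a polynomial of degree at most two, so its
first differences are affine. -/
theorem exists_sub_eq_affine : ∀ e : Lbl → Lbl, ∀ a : Lbl, ∃ c b : Lbl, ∀ j,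
    e (j + a) - e j = c + b * j := by
  decide

/-- A diagonal unitary is Clifford when the cubes of its entries agree. -/
theorem diagonal_mem_clifford₁ {d : Ket} (h1 : ∀ j, ‖d j‖ = 1) (h3 : ∀ i j, d i ^ 3 = d j ^ 3) :
    Matrix.diagonal d ∈ clifford₁ := by
  -- Up to the global phase `d 0`, the entries are cube roots of unity.
  have he : ∀ j, ∃ e, d j = d 0 * chi e := by
    intro j
    have h0 : d 0 ≠ 0 := by intro h; simpa [h] using h1 0
    obtain ⟨e, he⟩ := exists_chi_of_cube_eq_one (z := d j / d 0)
      (by rw [div_pow, h3 j 0, div_self (pow_ne_zero 3 h0)])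
    exact ⟨e, by rw [← he, mul_div_cancel₀ _ h0]⟩
  choose e he using he
  refine mem_unitaryNormalizer_of_finite finite_pauli₁ ?_ fun P hP => ?_
  · rw [Matrix.mem_unitaryGroup_iff, Matrix.star_eq_conjTranspose, Matrix.diagonal_conjTranspose,
      Matrix.diagonal_mul_diagonal, ← Matrix.diagonal_one]
    congr 1; ext j; exact mul_star_of_norm_eq_one (h1 j)
  · obtain ⟨c, a, b, rfl⟩ := mem_pauli₁.1 hP
    obtain ⟨c', b', h⟩ := exists_sub_eq_affine e a
    refine mem_pauli₁.2 ⟨c + c', a, b + b', ?_⟩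
    ext i j
    rw [diagonal_conj_apply, Matrix.smul_apply, Matrix.smul_apply, weyl_apply, weyl_apply]
    by_cases hij : i = j + a
    · subst hij
      have h4 : d (j + a) * star (d j) = chi (c' + b' * j) := by
        rw [← h, he (j + a), he j, star_mul, star_chi, sub_eq_add_neg, chi_add]
        linear_combination chi (e (j + a)) * chi (-e j) * mul_star_of_norm_eq_one (h1 0)
      rw [if_pos rfl, if_pos rfl, smul_eq_mul, smul_eq_mul, add_mul b, chi_add, chi_add]
      rw [chi_add] at h4
      linear_combination chi c * chi (b * j) * h4
    · simp [hij]

/-- The cubes of the entries of a diagonal Clifford gate agree. -/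
theorem cube_eq_of_diagonal_mem_clifford₁ {d : Ket} (h1 : ∀ j, ‖d j‖ = 1)
    (h : Matrix.diagonal d ∈ clifford₁) (i j : Lbl) : d i ^ 3 = d j ^ 3 := by
  -- The shift by `i - j` has entry `1` at `(i, j)`, so its conjugate has `d i * star (d j)` there.
  -- This is a nonzero entry of a Pauli operator, hence a cube root of unity.
  obtain ⟨c, a', b, hP⟩ := mem_pauli₁.1
    (conj_mem_of_mem_unitaryNormalizer h (mem_pauli₁.2 ⟨0, i - j, 0, rfl⟩))
  have h2 := congrFun (congrFun hP i) j
  rw [diagonal_conj_apply, chi_zero, one_smul, weyl_apply, Matrix.smul_apply, weyl_apply,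
    if_pos (by ring), zero_mul, chi_zero, mul_one, smul_eq_mul] at h2
  have hj := mul_star_of_norm_eq_one (h1 j)
  have hj0 : d j ≠ 0 := left_ne_zero_of_mul_eq_one hj
  have hi0 : d i ≠ 0 := left_ne_zero_of_mul_eq_one (mul_star_of_norm_eq_one (h1 i))
  split_ifs at h2 with hc
  · have h3 : (d i * star (d j)) ^ 3 = 1 := by rw [h2, mul_pow, chi_cube, chi_cube, one_mul]
    have h4 : (d j * star (d j)) ^ 3 = 1 := by rw [hj, one_pow]
    rw [mul_pow] at h3 h4
    exact mul_right_cancel₀ (right_ne_zero_of_mul_eq_one h4) (h3.trans h4.symm)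
  · rw [mul_zero] at h2
    exact absurd h2 (mul_ne_zero hi0 (right_ne_zero_of_mul_eq_one hj))

theorem phaseGate_mem_clifford₁ : phaseGate ∈ clifford₁ := by
  have hω : ‖ω‖ = 1 := by rw [← chi_one]; exact norm_chi 1
  have h : ∀ j, (![1, 1, ω] : Ket) j ^ 3 = 1 := by
    intro j; fin_cases j <;> simp [ω_cube]
  refine diagonal_mem_clifford₁ (fun j => ?_) fun i j => (h i).trans (h j).symm
  fin_cases j <;> simp [hω]

theorem injectedGate_eq (φ : Ket) (m : Lbl) :
    injectedGate φ m = Matrix.diagonal fun j => (Real.sqrt 3 : ℂ) * φ (j + m) := by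
  ext i j
  rw [injectedGate, Matrix.smul_apply, branchOperator, Matrix.of_apply, branchOutput,
    Matrix.mulVec, dotProduct, Finset.sum_eq_single (i, m + i), Matrix.conjTranspose_apply,
    SUM_apply, if_pos rfl, star_one, one_mul, Matrix.diagonal_apply, smul_eq_mul, Pi.single_apply,
    add_comm m i]
  · by_cases hij : i = j <;> simp [hij]
  · intro p _ hp
    rw [Matrix.conjTranspose_apply, SUM_apply, if_neg hp, star_zero, zero_mul]
  · simp

theorem IsPhaseState.norm_sqrt_three_mul {φ : Ket} (h : IsPhaseState φ) (j : Lbl) :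
    ‖(Real.sqrt 3 : ℂ) * φ j‖ = 1 := by
  obtain ⟨θ, rfl⟩ := h
  rw [mul_div_cancel₀ _ sqrt_three_ne_zero, Complex.norm_exp_ofReal_mul_I]

theorem IsPhaseState.ne_zero {φ : Ket} (h : IsPhaseState φ) (j : Lbl) : φ j ≠ 0 := by
  intro h0
  simpa [h0] using h.norm_sqrt_three_mul j

/-- The gate injected by a phase state is Clifford iff the cubes of the amplitudes agree. -/
theorem injectedGate_mem_clifford₁_iff {φ : Ket} (h : IsPhaseState φ) (m : Lbl) :
    injectedGate φ m ∈ clifford₁ ↔ ∀ i j, φ i ^ 3 = φ j ^ 3 := by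
  rw [injectedGate_eq]
  have h1 : ∀ j, ‖(Real.sqrt 3 : ℂ) * φ (j + m)‖ = 1 := fun j => h.norm_sqrt_three_mul _
  refine ⟨fun hd i j => ?_, fun h3 => diagonal_mem_clifford₁ h1 fun i j => ?_⟩
  · have := cube_eq_of_diagonal_mem_clifford₁ h1 hd (i - m) (j - m)
    simp only [sub_add_cancel, mul_pow] at this
    exact mul_left_cancel₀ (pow_ne_zero 3 sqrt_three_ne_zero) this
  · rw [mul_pow, mul_pow, h3]

/-! ### The action of the gates on vectors -/

theorem kronecker_one_mulVec (A : Op) (v : Lbl × Lbl → ℂ) (a b : Lbl) :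
    ((A ⊗ₖ (1 : Op)) *ᵥ v) (a, b) = ∑ k, A a k * v (k, b) := by
  simp [Matrix.mulVec, dotProduct, Fintype.sum_prod_type, Matrix.one_apply]

theorem one_kronecker_mulVec (A : Op) (v : Lbl × Lbl → ℂ) (a b : Lbl) :
    (((1 : Op) ⊗ₖ A) *ᵥ v) (a, b) = ∑ k, A b k * v (a, k) := by
  simp [Matrix.mulVec, dotProduct, Fintype.sum_prod_type, Matrix.one_apply]

/-- The two-qutrit vector with amplitudes `M a b`. -/
def grid (M : Op) : Lbl × Lbl → ℂ := fun p => M p.1 p.2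

/-- With amplitudes arranged as a matrix, gates on qutrit 1 multiply on the left and gates on qutrit
2 multiply on the right by their transpose. -/
theorem H₁_mulVec_grid (M : Op) : H₁ *ᵥ grid M = grid (had * M) := by
  ext ⟨a, b⟩; rw [H₁, kronecker_one_mulVec]; rfl

theorem H₁_conjTranspose_mulVec_grid (M : Op) : H₁ᴴ *ᵥ grid M = grid (hadᴴ * M) := by
  ext ⟨a, b⟩
  rw [H₁, Matrix.conjTranspose_kronecker, Matrix.conjTranspose_one, kronecker_one_mulVec]; rfl

theorem H₂_mulVec_grid (M : Op) : H₂ *ᵥ grid M = grid (M * hadᵀ) := by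
  ext ⟨a, b⟩; rw [H₂, one_kronecker_mulVec, grid, Matrix.mul_apply]
  exact Finset.sum_congr rfl fun k _ => mul_comm _ _

theorem S₂_mulVec_grid (M : Op) : S₂ *ᵥ grid M = grid (M * phaseGate) := by
  ext ⟨a, b⟩
  have h : phaseGateᵀ = phaseGate := Matrix.diagonal_transpose _
  rw [S₂, one_kronecker_mulVec, grid, Matrix.mul_apply]
  refine Finset.sum_congr rfl fun k _ => ?_
  rw [mul_comm]
  congr 1
  exact congrFun (congrFun h k) b

theorem SUM_mulVec (v : Lbl × Lbl → ℂ) (a b : Lbl) : (SUM *ᵥ v) (a, b) = v (a, b - a) := by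
  rw [Matrix.mulVec, dotProduct, Finset.sum_eq_single (a, b - a), SUM_apply, if_pos (by simp),
    one_mul]
  · intro p _ hp
    rw [SUM_apply, if_neg, zero_mul]
    rintro h
    apply hp
    rw [Prod.mk.injEq] at h
    ext1
    · exact h.1.symm
    · change p.2 = b - a
      rw [h.2, h.1, add_sub_cancel_right]
  · simp

theorem SUM_mulVec_grid (a b c d e f g h i : ℂ) :
    SUM *ᵥ grid !![a, b, c; d, e, f; g, h, i] = grid !![a, b, c; f, d, e; h, i, g] := by
  ext ⟨x, y⟩
  rw [SUM_mulVec]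
  fin_cases x <;> fin_cases y <;> simp [grid, show (-1 : Lbl) = 2 from rfl,
    show (-2 : Lbl) = 1 from rfl, show (2 - 1 : Lbl) = 1 from rfl, show (1 - 2 : Lbl) = 2 from rfl]

/-- Writing `1/√3` as `√3/3` keeps all amplitudes polynomial in `ω` and `√3`, so grid identities
hold modulo `ω² + ω + 1 = 0` and `s² = 3`. -/
theorem had_eq : had = ((Real.sqrt 3 : ℂ) / 3) • !![1, 1, 1; 1, ω, ω ^ 2; 1, ω ^ 2, ω] := by
  have h : (Real.sqrt 3 : ℂ)⁻¹ = (Real.sqrt 3 : ℂ) / 3 := by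
    rw [eq_div_iff (by norm_num), ← sqrt_three_sq, pow_two,
      inv_mul_cancel_left₀ sqrt_three_ne_zero]
  have h4 : ω ^ 4 = ω := by linear_combination ω * ω_cube
  ext i j
  fin_cases i <;> fin_cases j <;> simp [had, div_eq_mul_inv _ (Real.sqrt 3 : ℂ), h, mul_comm, h4]

theorem had_conjTranspose_eq :
    hadᴴ = ((Real.sqrt 3 : ℂ) / 3) • !![1, 1, 1; 1, ω ^ 2, ω; 1, ω, ω ^ 2] := by
  have h : (starRingEnd ℂ) ω = ω ^ 2 := star_ω
  have h4 : (ω ^ 2) ^ 2 = ω := by linear_combination ω * ω_cube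
  rw [had_eq]
  ext i j
  fin_cases i <;> fin_cases j <;> simp [h, h4]

/-! ### The circuits are Clifford -/

theorem H₁_mem_clifford₂ : H₁ ∈ clifford₂ :=
  kronecker_mem_clifford₂ had_mem_clifford₁ one_mem_clifford₁

theorem H₂_mem_clifford₂ : H₂ ∈ clifford₂ :=
  kronecker_mem_clifford₂ one_mem_clifford₁ had_mem_clifford₁

theorem S₂_mem_clifford₂ : S₂ ∈ clifford₂ :=
  kronecker_mem_clifford₂ one_mem_clifford₁ phaseGate_mem_clifford₁

theorem mul_mem_clifford₂ {U V : Op₂} (hU : U ∈ clifford₂) (hV : V ∈ clifford₂) :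
    U * V ∈ clifford₂ :=
  mul_mem_unitaryNormalizer hU hV

theorem circuitH3_mem_clifford₂ : circuitH3 ∈ clifford₂ := by
  have h₁ := H₁_mem_clifford₂
  have h₂ := H₂_mem_clifford₂
  have hs := SUM_mem_clifford₂
  have h := mul_mem_clifford₂ (mul_mem_clifford₂ (mul_mem_clifford₂ h₂ h₂) h₁) hs
  have h' := mul_mem_clifford₂ (mul_mem_clifford₂ (mul_mem_clifford₂ h S₂_mem_clifford₂) h₁) hs
  exact mul_mem_clifford₂ (mul_mem_clifford₂ (mul_mem_clifford₂ h' h₁) hs) h₁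

theorem circuitN_mem_clifford₂ : circuitN ∈ clifford₂ := by
  have h₁ := H₁_mem_clifford₂
  have h₂ := H₂_mem_clifford₂
  have hs := SUM_mem_clifford₂
  have h₁' : H₁ᴴ ∈ clifford₂ := conjTranspose_mem_unitaryNormalizer finite_pauli₂ h₁
  have h := mul_mem_clifford₂ (mul_mem_clifford₂ (mul_mem_clifford₂ h₁ hs) h₂) h₁'
  exact mul_mem_clifford₂ (mul_mem_clifford₂ (mul_mem_clifford₂ h hs) h₂) h₁

/-! ### The outputs of the circuits -/

theorem exp_pi_div_three : Complex.exp (Real.pi / 3 * Complex.I) = 1 + ω := by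
  have h : (Real.pi / 3 : ℂ) = ((Real.pi / 3 : ℝ) : ℂ) := by push_cast; ring
  rw [h, Complex.exp_mul_I, ← Complex.ofReal_cos, ← Complex.ofReal_sin, Real.cos_pi_div_three,
    Real.sin_pi_div_three, ω_eq]
  push_cast; ring

theorem I_eq : Complex.I = (2 * ω + 1) * (Real.sqrt 3 : ℂ) / 3 := by
  rw [ω_eq]; linear_combination -(Complex.I / 3) * sqrt_three_sq

/-- The phase state produced from two Hadamard eigenstates. -/
def phaseH3 : Ket := fun j =>
  ![1, Complex.I, Complex.exp (Real.pi / 3 * Complex.I)] j / (Real.sqrt 3 : ℂ)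

/-- The phase state produced from two Norrell states. -/
def phaseN : Ket := fun j => ![1, -1, -1] j / (Real.sqrt 3 : ℂ)

theorem isPhaseState_phaseH3 : IsPhaseState phaseH3 := by
  refine ⟨![0, Real.pi / 2, Real.pi / 3], ?_⟩
  ext j
  fin_cases j <;> simp [phaseH3, Complex.exp_pi_div_two_mul_I]

theorem isPhaseState_phaseN : IsPhaseState phaseN := by
  refine ⟨![0, Real.pi, Real.pi], ?_⟩
  ext j
  fin_cases j <;> simp [phaseN]

theorem injectedGate_zero (d : Ket) :
    injectedGate (fun j => d j / (Real.sqrt 3 : ℂ)) 0 = Matrix.diagonal d := by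
  rw [injectedGate_eq]
  congr 1; ext j
  rw [add_zero, mul_div_cancel₀ _ sqrt_three_ne_zero]

theorem injectedGate_phaseH3_notMem (m : Lbl) : injectedGate phaseH3 m ∉ clifford₁ := by
  rw [injectedGate_mem_clifford₁_iff isPhaseState_phaseH3]
  intro h
  -- The cube of the amplitude ratio would be `I ^ 3 = -I`, which is not `1`.
  have h2 := h 1 0
  have h3 := sqrt_three_ne_zero
  simp only [phaseH3, div_pow] at h2
  rw [div_left_inj' (pow_ne_zero 3 h3)] at h2
  simp [Complex.ext_iff] at h2

theorem injectedGate_phaseN_notMem (m : Lbl) : injectedGate phaseN m ∉ clifford₁ := by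
  rw [injectedGate_mem_clifford₁_iff isPhaseState_phaseN]
  intro h
  have h2 := h 1 0
  simp only [phaseN, div_pow] at h2
  rw [div_left_inj' (pow_ne_zero 3 sqrt_three_ne_zero)] at h2
  norm_num at h2

theorem successProb_of_eq_smul {C : Op₂} {M φ : Ket} {k : Lbl} {c : ℂ} (hφ : IsPhaseState φ)
    (h : twoCopyOutput C M k = c • φ) : successProb C M k = ‖c‖ ^ 2 := by
  have h1 : ∀ i, ‖twoCopyOutput C M k i‖ ^ 2 = ‖c‖ ^ 2 / 3 := by
    intro i
    have h2 := congrArg (· ^ 2) (hφ.norm_sqrt_three_mul i)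
    simp only [norm_mul, mul_pow, Complex.norm_real, Real.norm_eq_abs, sq_abs, one_pow] at h2
    rw [Real.sq_sqrt (by norm_num)] at h2
    rw [h, Pi.smul_apply, smul_eq_mul, norm_mul, mul_pow]
    linear_combination ‖c‖ ^ 2 / 3 * h2
  rw [successProb, Finset.sum_congr rfl fun i _ => h1 i, sum_lbl]
  ring

/-! ### Amplitude grids through the two circuits -/

theorem sqrt_three_lt : Real.sqrt 3 < 3 := by
  rw [Real.sqrt_lt' (by norm_num)]; norm_num

theorem three_sub_sqrt_three_ne_zero : (3 - Real.sqrt 3 : ℂ) ≠ 0 := by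
  have h : (3 - Real.sqrt 3 : ℝ) ≠ 0 := (sub_pos.2 sqrt_three_lt).ne'
  exact_mod_cast h

theorem ketH3_mul (a b : Lbl) : ketH3 a * ketH3 b =
    (![1, (Real.sqrt 3 - 1) / 2, (Real.sqrt 3 - 1) / 2] a : ℂ) *
      ![1, (Real.sqrt 3 - 1) / 2, (Real.sqrt 3 - 1) / 2] b / (3 - Real.sqrt 3) := by
  have h : (Real.sqrt (3 - Real.sqrt 3) : ℂ) * (Real.sqrt (3 - Real.sqrt 3) : ℂ) =
      3 - Real.sqrt 3 := by
    rw [← Complex.ofReal_mul, Real.mul_self_sqrt (sub_pos.2 sqrt_three_lt).le]; simp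
  simp only [ketH3]
  rw [div_mul_div_comm, h]

theorem ketN_mul (a b : Lbl) : ketN a * ketN b = (![1, 1, -2] a : ℂ) * ![1, 1, -2] b / 6 := by
  have h : (Real.sqrt 6 : ℂ) * (Real.sqrt 6 : ℂ) = 6 := by
    rw [← Complex.ofReal_mul, Real.mul_self_sqrt (by norm_num)]; simp
  simp only [ketN]
  rw [div_mul_div_comm, h]

/-- The grid is fixed because each column is a multiple of the Hadamard eigenvector with eigenvalue
`1`. -/
theorem had_mul_ketH3_grid {s : ℂ} (hs : s = Real.sqrt 3) :
    had * !![1, (-1 + s) / 2, (-1 + s) / 2; (-1 + s) / 2, (2 - s) / 2, (2 - s) / 2;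
    (-1 + s) / 2, (2 - s) / 2, (2 - s) / 2] =
    !![1, (-1 + s) / 2, (-1 + s) / 2; (-1 + s) / 2, (2 - s) / 2, (2 - s) / 2;
    (-1 + s) / 2, (2 - s) / 2, (2 - s) / 2] := by
  have h1 := ω_sum
  have h2 := sqrt_three_sq
  rw [← hs] at h2
  rw [had_eq, ← hs]
  ext i j
  fin_cases i <;> fin_cases j <;> simp [Matrix.mul_apply, sum_lbl] <;> grind

theorem had_mul_sum_ketH3_grid {s : ℂ} (hs : s = Real.sqrt 3) :
    had * !![1, (-1 + s) / 2, (-1 + s) / 2; (2 - s) / 2, (-1 + s) / 2, (2 - s) / 2;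
    (2 - s) / 2, (2 - s) / 2, (-1 + s) / 2] =
    !![-1 + s, 1 / 2, 1 / 2; 1 / 2, (2 + 2 * ω - s - s * ω) / 2, (-2 * ω + s * ω) / 2;
    1 / 2, (-2 * ω + s * ω) / 2, (2 + 2 * ω - s - s * ω) / 2] := by
  have h1 := ω_sum
  have h2 := sqrt_three_sq
  rw [← hs] at h2
  rw [had_eq, ← hs]
  ext i j
  fin_cases i <;> fin_cases j <;> simp [Matrix.mul_apply, sum_lbl] <;> grind

theorem had_mul_mul_phaseGate_grid {s : ℂ} (hs : s = Real.sqrt 3) :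
    had * !![-1 + s, 1 / 2, 1 / 2;
    (-2 * ω + s * ω) / 2, 1 / 2, (2 + 2 * ω - s - s * ω) / 2;
    (-2 * ω + s * ω) / 2, (2 + 2 * ω - s - s * ω) / 2, 1 / 2] * phaseGate =
    !![(3 + 3 * ω - s - 2 * s * ω) / 3, (-3 - 3 * ω + 4 * s + 2 * s * ω) / 6,
    (3 - 2 * s + 2 * s * ω) / 6;
    (6 - 3 * ω - 2 * s + 2 * s * ω) / 6, (3 * ω + s - s * ω) / 6, (3 * ω + s - s * ω) / 6;
    (6 - 3 * ω - 2 * s + 2 * s * ω) / 6, (3 - 2 * s - s * ω) / 6,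
    (-3 - 3 * ω + s + 2 * s * ω) / 6] := by
  have h1 := ω_sum
  have h2 := sqrt_three_sq
  rw [← hs] at h2
  rw [had_eq, ← hs, phaseGate]
  ext i j
  fin_cases i <;> fin_cases j <;> simp [Matrix.mul_apply, sum_lbl] <;> grind

theorem had_mul_phased_grid {s : ℂ} (hs : s = Real.sqrt 3) :
    had * !![(3 + 3 * ω - s - 2 * s * ω) / 3, (-3 - 3 * ω + 4 * s + 2 * s * ω) / 6,
    (3 - 2 * s + 2 * s * ω) / 6;
    (3 * ω + s - s * ω) / 6, (6 - 3 * ω - 2 * s + 2 * s * ω) / 6, (3 * ω + s - s * ω) / 6;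
    (3 - 2 * s - s * ω) / 6, (-3 - 3 * ω + s + 2 * s * ω) / 6,
    (6 - 3 * ω - 2 * s + 2 * s * ω) / 6] =
    !![(-1 - 2 * ω + s + s * ω) / 2, (1 + 2 * ω - s * ω) / 2, (-1 + ω + s) / 2;
    0, (1 - ω + s * ω) / 2, (1 + 2 * ω - s - s * ω) / 2;
    (-1 - 2 * ω + s + s * ω) / 2, (2 + ω - s - s * ω) / 2, (-2 - ω + s + s * ω) / 2] := by
  have h1 := ω_sum
  have h2 := sqrt_three_sq
  rw [← hs] at h2
  rw [had_eq, ← hs]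
  ext i j
  fin_cases i <;> fin_cases j <;> simp [Matrix.mul_apply, sum_lbl] <;> grind

/-- The square of the Fourier transform is the parity `j ↦ -j`; on the ancilla it only exchanges
outcomes `1` and `2`. -/
theorem had_transpose_mul_self {s : ℂ} (hs : s = Real.sqrt 3) :
    hadᵀ * hadᵀ = !![1, 0, 0; 0, 0, 1; 0, 1, 0] := by
  have h1 := ω_sum
  have h2 := sqrt_three_sq
  rw [← hs] at h2
  rw [had_eq, ← hs]
  ext i j
  fin_cases i <;> fin_cases j <;> simp [Matrix.mul_apply, sum_lbl] <;> grind

theorem circuitH3_mulVec (s : ℂ) (hs : s = Real.sqrt 3) :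
    circuitH3 *ᵥ grid !![1, (-1 + s) / 2, (-1 + s) / 2; (-1 + s) / 2, (2 - s) / 2, (2 - s) / 2;
      (-1 + s) / 2, (2 - s) / 2, (2 - s) / 2] =
    grid !![(-1 - 2 * ω + s + s * ω) / 2, (-1 + ω + s) / 2, (1 + 2 * ω - s * ω) / 2;
      0, (1 + 2 * ω - s - s * ω) / 2, (1 - ω + s * ω) / 2;
      (-1 - 2 * ω + s + s * ω) / 2, (-2 - ω + s + s * ω) / 2, (2 + ω - s - s * ω) / 2] := by
  simp only [circuitH3, ← Matrix.mulVec_mulVec]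
  rw [H₁_mulVec_grid, had_mul_ketH3_grid hs, SUM_mulVec_grid, H₁_mulVec_grid,
    had_mul_sum_ketH3_grid hs, SUM_mulVec_grid, H₁_mulVec_grid,
    S₂_mulVec_grid, had_mul_mul_phaseGate_grid hs, SUM_mulVec_grid, H₁_mulVec_grid,
    had_mul_phased_grid hs, H₂_mulVec_grid, H₂_mulVec_grid,
    Matrix.mul_assoc, had_transpose_mul_self hs]
  congr 1
  ext i j
  fin_cases i <;> fin_cases j <;> simp [Matrix.mul_apply, sum_lbl]

theorem had_mul_ketN_grid_mul {s : ℂ} (hs : s = Real.sqrt 3) :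
    had * !![1, 1, -2; 1, 1, -2; -2, -2, 4] * hadᵀ =
    !![0, 0, 0; 0, 3 * ω, 3; 0, 3, -3 - 3 * ω] := by
  have h1 := ω_sum
  have h2 := sqrt_three_sq
  rw [← hs] at h2
  rw [had_eq, ← hs]
  ext i j
  fin_cases i <;> fin_cases j <;> simp [Matrix.mul_apply, sum_lbl] <;> grind

theorem had_conjTranspose_mul_grid_mul {s : ℂ} (hs : s = Real.sqrt 3) :
    hadᴴ * !![0, 0, 0; 3, 0, 3 * ω; 3, -3 - 3 * ω, 0] * hadᵀ =
    !![1, 4, 1; 1, -2, -2; -2, -2, 1] := by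
  have h1 := ω_sum
  have h2 := sqrt_three_sq
  rw [← hs] at h2
  rw [had_conjTranspose_eq, had_eq, ← hs]
  ext i j
  fin_cases i <;> fin_cases j <;> simp [Matrix.mul_apply, sum_lbl] <;> grind

theorem had_mul_last_grid {s : ℂ} (hs : s = Real.sqrt 3) :
    had * !![1, 4, 1; -2, 1, -2; -2, 1, -2] = !![-s, 2 * s, -s; s, s, s; s, s, s] := by
  have h1 := ω_sum
  have h2 := sqrt_three_sq
  rw [← hs] at h2
  rw [had_eq, ← hs]
  ext i j
  fin_cases i <;> fin_cases j <;> simp [Matrix.mul_apply, sum_lbl] <;> grind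

theorem circuitN_mulVec (s : ℂ) (hs : s = Real.sqrt 3) :
    circuitN *ᵥ grid !![1, 1, -2; 1, 1, -2; -2, -2, 4] =
      grid !![-s, 2 * s, -s; s, s, s; s, s, s] := by
  simp only [circuitN, ← Matrix.mulVec_mulVec]
  rw [H₁_mulVec_grid, H₂_mulVec_grid, had_mul_ketN_grid_mul hs, SUM_mulVec_grid,
    H₁_conjTranspose_mulVec_grid, H₂_mulVec_grid, had_conjTranspose_mul_grid_mul hs,
    SUM_mulVec_grid, H₁_mulVec_grid,
    had_mul_last_grid hs]

theorem twoCopyOutput_eq_smul {C : Op₂} {M : Ket} {c : ℂ} {A B : Op}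
    (hA : ∀ a b, M a * M b = c * A a b) (h : C *ᵥ grid A = grid B) (k i : Lbl) :
    twoCopyOutput C M k i = c * B i k := by
  have : (fun p : Lbl × Lbl => M p.1 * M p.2) = c • grid A := by
    ext p; exact hA p.1 p.2
  rw [twoCopyOutput, branchOutput, this, Matrix.mulVec_smul, h]; rfl

/-- The scalar is read off from the first amplitude, since the phase state starts with `1/√3`. -/
theorem twoCopyOutput_circuitH3 : twoCopyOutput circuitH3 ketH3 1 =
    ((Real.sqrt 3 : ℂ) * (Real.sqrt 3 - 1 + ω) / (2 * (3 - Real.sqrt 3))) • phaseH3 := by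
  obtain ⟨s, hs⟩ : ∃ s : ℂ, s = Real.sqrt 3 := ⟨_, rfl⟩
  have h1 := ω_sum
  have h2 := sqrt_three_sq
  have h3 := sqrt_three_ne_zero
  have h4 := three_sub_sqrt_three_ne_zero
  ext i
  rw [twoCopyOutput_eq_smul (c := (3 - s)⁻¹) _ (circuitH3_mulVec s hs), Pi.smul_apply, phaseH3,
    exp_pi_div_three, I_eq, smul_eq_mul]
  · rw [← hs] at h2 h3 h4 ⊢
    fin_cases i <;> simp <;> field_simp <;> grind
  · intro a b
    rw [ketH3_mul]
    rw [← hs] at h2 h3 h4 ⊢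
    fin_cases a <;> fin_cases b <;> simp [← hs] <;> field_simp <;> grind

theorem twoCopyOutput_circuitN : twoCopyOutput circuitN ketN 0 = (-1 / 2 : ℂ) • phaseN := by
  obtain ⟨s, hs⟩ : ∃ s : ℂ, s = Real.sqrt 3 := ⟨_, rfl⟩
  have h2 := sqrt_three_sq
  have h3 := sqrt_three_ne_zero
  ext i
  rw [twoCopyOutput_eq_smul (c := 1 / 6) _ (circuitN_mulVec s hs), Pi.smul_apply, phaseN,
    smul_eq_mul]
  · rw [← hs] at h2 h3 ⊢
    fin_cases i <;> simp <;> field_simp <;> grind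
  · intro a b
    rw [ketN_mul]
    fin_cases a <;> fin_cases b <;> norm_num

theorem norm_sq_coeffH3 :
    ‖(Real.sqrt 3 : ℂ) * (Real.sqrt 3 - 1 + ω) / (2 * (3 - Real.sqrt 3))‖ ^ 2 = 3 / 8 := by
  have hs : Real.sqrt 3 ^ 2 = 3 := Real.sq_sqrt (by norm_num)
  have hd : (3 - Real.sqrt 3) ≠ 0 := (sub_pos.2 sqrt_three_lt).ne'
  have hz : (Real.sqrt 3 : ℂ) * (Real.sqrt 3 - 1 + ω) / (2 * (3 - Real.sqrt 3)) =
      ((Real.sqrt 3 / (2 * (3 - Real.sqrt 3)) : ℝ) : ℂ) *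
        ((Real.sqrt 3 - 3 / 2 : ℝ) + (Real.sqrt 3 / 2 : ℝ) * Complex.I) := by
    rw [ω_eq]; push_cast; ring
  rw [hz, norm_mul, mul_pow, ← Complex.normSq_eq_norm_sq (_ + _), Complex.normSq_add_mul_I,
    Complex.norm_real, Real.norm_eq_abs, sq_abs]
  field_simp
  grind

/-! ### Symmetrized two-qutrit Weyl operators -/

/-- Phase-space points of two qutrits. -/
abbrev Pt : Type := (Lbl × Lbl) × (Lbl × Lbl)

/-- The Weyl operator `ω ^ (-a b) X ^ a Z ^ b`, with the phase that makes the product of commuting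
operators additive. -/
def sweyl (p : Lbl × Lbl) : Op := chi (-(p.1 * p.2)) • weyl p.1 p.2

/-- The two-qutrit Weyl operator at a phase-space point. -/
def sweyl₂ (u : Pt) : Op₂ := sweyl u.1 ⊗ₖ sweyl u.2

/-- The symplectic form. -/
def sympl (u v : Pt) : Lbl :=
  u.1.1 * v.1.2 - u.1.2 * v.1.1 + (u.2.1 * v.2.2 - u.2.2 * v.2.1)

/-- Modulo `3`, `-1` is the inverse of `2`, so the prefactor in `sweyl` is the symmetric-ordering
phase and only the antisymmetric form survives. -/
theorem sweyl_mul (p r : Lbl × Lbl) :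
    sweyl p * sweyl r = chi (p.1 * r.2 - p.2 * r.1) • sweyl (p + r) := by
  have h : ∀ a b a' b' : Lbl, -(a * b) + (-(a' * b') + b * a') =
      a * b' - b * a' + -((a + a') * (b + b')) := by decide
  rw [sweyl, sweyl, sweyl, Matrix.smul_mul, Matrix.mul_smul, weyl_mul, smul_smul, smul_smul,
    smul_smul, ← chi_add, ← chi_add, ← chi_add, add_assoc, h]
  rfl

theorem sweyl₂_mul (u v : Pt) :
    sweyl₂ u * sweyl₂ v = chi (sympl u v) • sweyl₂ (u + v) := by
  rw [sweyl₂, sweyl₂, ← Matrix.mul_kronecker_mul, sweyl_mul, sweyl_mul, Matrix.smul_kronecker,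
    Matrix.kronecker_smul, smul_smul, ← chi_add]
  rfl

theorem sweyl₂_zero : sweyl₂ 0 = 1 := by simp [sweyl₂, sweyl, weyl_zero]

theorem sympl_self (u : Pt) : sympl u u = 0 := by rw [sympl]; ring

theorem sympl_neg_self (u : Pt) : sympl u (-u) = 0 := by
  simp only [sympl, Prod.fst_neg, Prod.snd_neg]; ring

theorem sympl_swap (u v : Pt) : sympl v u = -sympl u v := by rw [sympl, sympl]; ring

theorem sympl_smul_right (u v : Pt) (c : Lbl) : sympl u (c • v) = c * sympl u v := by
  simp only [sympl, Prod.smul_fst, Prod.smul_snd, smul_eq_mul]; ring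

theorem sweyl₂_ne_zero (u : Pt) : sweyl₂ u ≠ 0 := by
  intro h
  have h1 := sweyl₂_mul u (-u)
  rw [h, sympl_neg_self, add_neg_cancel, sweyl₂_zero, zero_mul, chi_zero, one_smul] at h1
  exact zero_ne_one h1

theorem sympl_eq_zero_of_commute {u v : Pt} (h : sweyl₂ u * sweyl₂ v = sweyl₂ v * sweyl₂ u) :
    sympl u v = 0 := by
  rw [sweyl₂_mul, sweyl₂_mul, add_comm v u] at h
  have h1 : chi (sympl u v) = chi (sympl v u) := smul_left_injective ℂ (sweyl₂_ne_zero _) h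
  rw [sympl_swap u v] at h1
  have h2 := chi_neg_mul_self (sympl u v)
  rw [← h1, ← chi_add, chi_eq_one_iff] at h2
  have h3 : ∀ x : Lbl, x + x = 0 → x = 0 := by decide
  exact h3 _ h2

theorem weyl_eq_smul_sweyl (a b : Lbl) : weyl a b = chi (a * b) • sweyl (a, b) := by
  rw [sweyl, smul_smul, ← chi_add]; simp

theorem exists_sweyl₂_of_mem_pauli₂ {P : Op₂} (h : P ∈ pauli₂) :
    ∃ s u, P = chi s • sweyl₂ u := by
  obtain ⟨c, a, b, a', b', rfl⟩ := mem_pauli₂.1 h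
  refine ⟨c + (a * b + a' * b'), ((a, b), (a', b')), ?_⟩
  rw [weyl_eq_smul_sweyl, weyl_eq_smul_sweyl, Matrix.smul_kronecker, Matrix.kronecker_smul,
    smul_smul, smul_smul, ← chi_add, ← chi_add, add_assoc]
  rfl

theorem kronecker_weyl_mem_pauli₂ (a b a' b' : Lbl) : weyl a b ⊗ₖ weyl a' b' ∈ pauli₂ :=
  mem_pauli₂.2 ⟨0, a, b, a', b', by rw [chi_zero, one_smul]⟩

theorem sweyl₂_mem_pauli₂ (u : Pt) : sweyl₂ u ∈ pauli₂ := by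
  refine mem_pauli₂.2
    ⟨-(u.1.1 * u.1.2) + -(u.2.1 * u.2.2), u.1.1, u.1.2, u.2.1, u.2.2, ?_⟩
  rw [sweyl₂, sweyl, sweyl, Matrix.smul_kronecker, Matrix.kronecker_smul, smul_smul, ← chi_add]

/-! ### Expectation values in two Strange states -/

/-- Twice the expectation value of `sweyl p` in the Strange state. -/
def strangeValue (p : Lbl × Lbl) : ℤ := if p = 0 then 2 else -1

/-- Four times the expectation value of `sweyl₂ u` in two Strange states. -/
def strangeValue₂ (u : Pt) : ℤ := strangeValue u.1 * strangeValue u.2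

/-- The product of two Strange states. -/
def strange₂ : Lbl × Lbl → ℂ := fun p => ketS p.1 * ketS p.2

theorem dotProduct_kronecker (A B : Op) (φ ψ : Ket) :
    (star fun p : Lbl × Lbl => φ p.1 * ψ p.2) ⬝ᵥ ((A ⊗ₖ B) *ᵥ fun p => φ p.1 * ψ p.2) =
      (star φ ⬝ᵥ A *ᵥ φ) * (star ψ ⬝ᵥ B *ᵥ ψ) := by
  simp only [dotProduct, Matrix.mulVec, Matrix.kroneckerMap_apply, Fintype.sum_prod_type,
    Pi.star_apply, star_mul', Finset.mul_sum, Finset.sum_mul]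
  simp only [sum_lbl]
  ring

theorem dotProduct_sweyl_ketS (p : Lbl × Lbl) :
    star ketS ⬝ᵥ sweyl p *ᵥ ketS = (strangeValue p : ℂ) / 2 := by
  have h2 : ((Real.sqrt 2 : ℂ))⁻¹ * (Real.sqrt 2 : ℂ)⁻¹ = 1 / 2 := by
    rw [← mul_inv, ← Complex.ofReal_mul, Real.mul_self_sqrt (by norm_num)]; norm_num
  have hω := ω_sum
  have hS : ketS = (Real.sqrt 2 : ℂ)⁻¹ • (![0, 1, -1] : Ket) := by
    ext j; rw [ketS, div_eq_inv_mul]; rfl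
  have hstar : star ketS = (Real.sqrt 2 : ℂ)⁻¹ • (![0, 1, -1] : Ket) := by
    rw [hS]; ext j; fin_cases j <;> simp [Complex.conj_ofReal]
  have key : (![0, 1, -1] : Ket) ⬝ᵥ (sweyl p *ᵥ (![0, 1, -1] : Ket)) = strangeValue p := by
    have h1 : (-1 : Lbl) = 2 := rfl
    have h2' : (-2 : Lbl) = 1 := rfl
    obtain ⟨a, b⟩ := p
    rw [sweyl, Matrix.smul_mulVec, dotProduct_smul]
    simp only [dotProduct, Matrix.mulVec, sum_lbl, weyl_apply]
    fin_cases a <;> fin_cases b <;> simp [strangeValue, h1, h2', chi_one, chi_two] <;> grind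
  rw [hstar, hS, Matrix.mulVec_smul, smul_dotProduct, dotProduct_smul, smul_smul, h2, key,
    smul_eq_mul]
  ring

theorem dotProduct_sweyl₂_strange₂ (u : Pt) :
    star strange₂ ⬝ᵥ sweyl₂ u *ᵥ strange₂ = (strangeValue₂ u : ℂ) / 4 := by
  unfold strange₂
  rw [sweyl₂, dotProduct_kronecker, dotProduct_sweyl_ketS, dotProduct_sweyl_ketS,
    strangeValue₂]
  push_cast; ring

/-- Up to a factor, the expectation value of `sweyl₂ u` after projecting two Strange states on an
eigenspace of `sweyl₂ v`. -/
def projectedValue (w : Lbl) (v u : Pt) : ℂ := ∑ c, chi (w * c) * strangeValue₂ (u + c • v)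

/-- Moving the base point along the line only relabels the summation variable. -/
theorem projectedValue_sub_smul (w : Lbl) (v u : Pt) (e : Lbl) :
    projectedValue w v (u - e • v) = chi (w * e) * projectedValue w v u := by
  rw [projectedValue, projectedValue, Finset.mul_sum, ← Equiv.sum_comp (Equiv.addRight e)]
  refine Finset.sum_congr rfl fun c _ => ?_
  have h : u - e • v + (c + e) • v = u + c • v := by rw [add_smul]; abel
  rw [Equiv.coe_addRight, h, mul_add, chi_add]
  ring

/-! ### Vanishing weighted sums along lines of phase space -/

theorem int_eq_of_add_ω_mul_eq_zero {x y z : ℤ} (h : (x + ω * y + ω ^ 2 * z : ℂ) = 0) :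
    x = y ∧ y = z := by
  have h2 : ω ^ 2 = -1 - ω := by linear_combination ω_sum
  rw [h2, ω_eq] at h
  have him := congrArg Complex.im h
  have hre := congrArg Complex.re h
  simp at him hre
  have h3 : (0 : ℝ) < Real.sqrt 3 := by positivity
  have hyz : (y : ℝ) = z := mul_left_cancel₀ h3.ne' (by linarith)
  have hxy : (x : ℝ) = y := by rw [← hyz] at hre; linarith
  exact ⟨by exact_mod_cast hxy, by exact_mod_cast hyz⟩

/-- The values of `strangeValue` along the line `r + c • p`. -/
theorem strangeValue_line : ∀ p r : Lbl × Lbl, ∃ x y z : ℤ,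
    (strangeValue (r + (0 : Lbl) • p) = x ∧ strangeValue (r + (1 : Lbl) • p) = y ∧
      strangeValue (r + (2 : Lbl) • p) = z) ∧
    (p = 0 ∧ r.1 * p.2 - r.2 * p.1 = 0 ∧ x = y ∧ y = z ∧ z ≠ 0 ∨
      p ≠ 0 ∧ r.1 * p.2 - r.2 * p.1 ≠ 0 ∧ x = -1 ∧ y = -1 ∧ z = -1 ∨
      p ≠ 0 ∧ r.1 * p.2 - r.2 * p.1 = 0 ∧
        (x = 2 ∧ y = -1 ∧ z = -1 ∨ x = -1 ∧ y = 2 ∧ z = -1 ∨ x = -1 ∧ y = -1 ∧ z = 2)) := by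
  -- Three cases for one qutrit: a degenerate line, a line missing the origin (all values `-1`), and
  -- a line through the origin (the value `2` exactly once). The symplectic form tells the last two
  -- apart.
  have h : ∀ p r : Lbl × Lbl,
    (p = 0 ∧ r.1 * p.2 - r.2 * p.1 = 0 ∧
        strangeValue (r + (0 : Lbl) • p) = strangeValue (r + (1 : Lbl) • p) ∧
        strangeValue (r + (1 : Lbl) • p) = strangeValue (r + (2 : Lbl) • p) ∧
        strangeValue (r + (2 : Lbl) • p) ≠ 0 ∨
      p ≠ 0 ∧ r.1 * p.2 - r.2 * p.1 ≠ 0 ∧ strangeValue (r + (0 : Lbl) • p) = -1 ∧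
        strangeValue (r + (1 : Lbl) • p) = -1 ∧ strangeValue (r + (2 : Lbl) • p) = -1 ∨
      p ≠ 0 ∧ r.1 * p.2 - r.2 * p.1 = 0 ∧
        (strangeValue (r + (0 : Lbl) • p) = 2 ∧ strangeValue (r + (1 : Lbl) • p) = -1 ∧
          strangeValue (r + (2 : Lbl) • p) = -1 ∨
        strangeValue (r + (0 : Lbl) • p) = -1 ∧ strangeValue (r + (1 : Lbl) • p) = 2 ∧
          strangeValue (r + (2 : Lbl) • p) = -1 ∨
        strangeValue (r + (0 : Lbl) • p) = -1 ∧ strangeValue (r + (1 : Lbl) • p) = -1 ∧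
          strangeValue (r + (2 : Lbl) • p) = 2)) := by
    decide +kernel
  exact fun p r => ⟨_, _, _, ⟨rfl, rfl, rfl⟩, h p r⟩

/-- The condition `sympl u v = 0` excludes a nondegenerate line missing the origin in one factor
unless it misses it in both or `v` already has exactly one zero component. If both components of `v`
vanish or neither does, the possible sums are all nonzero. -/
theorem strangeValue₂_sum_eq_zero_imp {v u : Pt} (huv : sympl u v = 0)
    (h : strangeValue₂ (u + (0 : Lbl) • v) + strangeValue₂ (u + (1 : Lbl) • v) +
      strangeValue₂ (u + (2 : Lbl) • v) = 0) : v.1 = 0 ∧ v.2 ≠ 0 ∨ v.1 ≠ 0 ∧ v.2 = 0 := by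
  obtain ⟨x, y, z, ⟨hx, hy, hz⟩, h1⟩ := strangeValue_line v.1 u.1
  obtain ⟨x', y', z', ⟨hx', hy', hz'⟩, h2⟩ := strangeValue_line v.2 u.2
  simp only [strangeValue₂, Prod.fst_add, Prod.snd_add, Prod.smul_fst, Prod.smul_snd, hx, hy, hz,
    hx', hy', hz'] at h
  rw [sympl] at huv
  rcases h1 with ⟨p1, b1, c1⟩ | ⟨p1, b1, c1⟩ | ⟨p1, b1, c1⟩ <;>
  rcases h2 with ⟨p2, b2, c2⟩ | ⟨p2, b2, c2⟩ | ⟨p2, b2, c2⟩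
  · obtain ⟨rfl, rfl, h0⟩ := c1
    obtain ⟨rfl, rfl, h0'⟩ := c2
    have : x * x' ≠ 0 := mul_ne_zero h0 h0'
    omega
  · exact Or.inl ⟨p1, p2⟩
  · exact Or.inl ⟨p1, p2⟩
  · exact Or.inr ⟨p1, p2⟩
  · obtain ⟨rfl, rfl, rfl⟩ := c1
    obtain ⟨rfl, rfl, rfl⟩ := c2
    omega
  · rw [b2, add_zero] at huv
    exact absurd huv b1
  · exact Or.inr ⟨p1, p2⟩
  · rw [b1, zero_add] at huv
    exact absurd huv b2
  · rcases c1 with ⟨rfl, rfl, rfl⟩ | ⟨rfl, rfl, rfl⟩ | ⟨rfl, rfl, rfl⟩ <;> omega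

theorem strangeValue₂_eq_imp {v u : Pt} (huv : sympl u v = 0)
    (h : strangeValue₂ (u + (0 : Lbl) • v) = strangeValue₂ (u + (1 : Lbl) • v))
    (h' : strangeValue₂ (u + (1 : Lbl) • v) = strangeValue₂ (u + (2 : Lbl) • v)) :
    v = 0 ∨ v.1 ≠ 0 ∧ v.2 ≠ 0 := by
  obtain ⟨x, y, z, ⟨hx, hy, hz⟩, h1⟩ := strangeValue_line v.1 u.1
  obtain ⟨x', y', z', ⟨hx', hy', hz'⟩, h2⟩ := strangeValue_line v.2 u.2
  simp only [strangeValue₂, Prod.fst_add, Prod.snd_add, Prod.smul_fst, Prod.smul_snd, hx, hy, hz,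
    hx', hy', hz'] at h h'
  rw [sympl] at huv
  rcases h1 with ⟨p1, b1, c1⟩ | ⟨p1, b1, c1⟩ | ⟨p1, b1, c1⟩ <;>
  rcases h2 with ⟨p2, b2, c2⟩ | ⟨p2, b2, c2⟩ | ⟨p2, b2, c2⟩
  · exact Or.inl (Prod.ext p1 p2)
  · rw [b1, zero_add] at huv
    exact absurd huv b2
  · rcases c2 with ⟨rfl, rfl, rfl⟩ | ⟨rfl, rfl, rfl⟩ | ⟨rfl, rfl, rfl⟩ <;> omega
  · rw [b2, add_zero] at huv
    exact absurd huv b1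
  · exact Or.inr ⟨p1, p2⟩
  · exact Or.inr ⟨p1, p2⟩
  · rcases c1 with ⟨rfl, rfl, rfl⟩ | ⟨rfl, rfl, rfl⟩ | ⟨rfl, rfl, rfl⟩ <;> omega
  · exact Or.inr ⟨p1, p2⟩
  · exact Or.inr ⟨p1, p2⟩

theorem strangeValue₂_sum_smul_eq_zero : ∀ v : Pt, v.1 = 0 ∧ v.2 ≠ 0 ∨ v.1 ≠ 0 ∧ v.2 = 0 →
    strangeValue₂ (0 + (0 : Lbl) • v) + strangeValue₂ (0 + (1 : Lbl) • v) +
      strangeValue₂ (0 + (2 : Lbl) • v) = 0 := by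
  decide +kernel

/-- For trivial weight the plain sum vanishes, which forces exactly one zero component of `v` and
kills the sum at the origin too. For nontrivial weight the three values must be equal, as `1, ω, ω²`
have only one integer relation up to scale. -/
theorem projectedValue_zero_eq_zero_or {w : Lbl} {v u : Pt} (huv : sympl u v = 0)
    (h : projectedValue w v u = 0) :
    projectedValue w v 0 = 0 ∨ w ≠ 0 ∧ v.1 ≠ 0 ∧ v.2 ≠ 0 := by
  have hω := ω_sum
  by_cases hw : w = 0
  · left
    subst hw
    rw [projectedValue, sum_lbl] at h ⊢
    simp only [zero_mul, chi_zero, one_mul] at h ⊢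
    have h' := strangeValue₂_sum_smul_eq_zero v
      (strangeValue₂_sum_eq_zero_imp huv (by exact_mod_cast h))
    exact_mod_cast h'
  · have hF : v = 0 ∨ v.1 ≠ 0 ∧ v.2 ≠ 0 := by
      rw [projectedValue, sum_lbl, mul_zero, mul_one, chi_zero, one_mul] at h
      have hw' : w = 1 ∨ w = 2 := by
        have : ∀ x : Lbl, x ≠ 0 → x = 1 ∨ x = 2 := by decide
        exact this w hw
      rcases hw' with rfl | rfl
      · rw [one_mul, chi_one, chi_two] at h
        obtain ⟨h1, h2⟩ := int_eq_of_add_ω_mul_eq_zero h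
        exact strangeValue₂_eq_imp huv h1 h2
      -- For `w = 2` the weights of `c = 1` and `c = 2` are interchanged.
      · have h4 : (2 * 2 : Lbl) = 1 := rfl
        rw [h4, chi_one, chi_two, add_right_comm] at h
        obtain ⟨h1, h2⟩ := int_eq_of_add_ω_mul_eq_zero h
        exact strangeValue₂_eq_imp huv (h1.trans h2) h2.symm
    rcases hF with rfl | hF
    · left
      have h1 := sum_chi_mul w
      rw [if_neg hw] at h1
      simp only [projectedValue, smul_zero, add_zero, ← Finset.sum_mul, h1, zero_mul]
    · exact Or.inr ⟨hw, hF⟩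

/-- The second line passes through `(2 • v.1, 0)` at `c = 1` and `(0, v.2)` at `c = 2`, which gives
the two values `-2`. -/
theorem strangeValue₂_of_ne_zero : ∀ v : Pt, v.1 ≠ 0 → v.2 ≠ 0 →
    strangeValue₂ (0 + (0 : Lbl) • v) = 4 ∧ strangeValue₂ (0 + (1 : Lbl) • v) = 1 ∧
    strangeValue₂ (0 + (2 : Lbl) • v) = 1 ∧
    strangeValue₂ ((v.1, -v.2) + (0 : Lbl) • v) = 1 ∧
    strangeValue₂ ((v.1, -v.2) + (1 : Lbl) • v) = -2 ∧
    strangeValue₂ ((v.1, -v.2) + (2 : Lbl) • v) = -2 := by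
  decide +kernel

theorem projectedValue_of_ne_zero {w : Lbl} {v : Pt} (hw : w ≠ 0) (h1 : v.1 ≠ 0)
    (h2 : v.2 ≠ 0) : projectedValue w v 0 = 3 ∧ projectedValue w v (v.1, -v.2) = 3 := by
  have hs := sum_chi_mul w
  rw [if_neg hw, sum_lbl, mul_zero, chi_zero] at hs
  obtain ⟨e1, e2, e3, e4, e5, e6⟩ := strangeValue₂_of_ne_zero v h1 h2
  constructor
  · rw [projectedValue, sum_lbl, e1, e2, e3, mul_zero, chi_zero]
    push_cast; linear_combination hs
  · rw [projectedValue, sum_lbl, e4, e5, e6, mul_zero, chi_zero]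
    push_cast; linear_combination -2 * hs

/-- The point is `((1 - e) • v.1, -(1 + e) • v.2)`, which is never the origin, and only the origin
has value `±4`. -/
theorem strangeValue₂_sub_smul_sq_ne : ∀ (v : Pt) (e : Lbl), v.1 ≠ 0 → v.2 ≠ 0 →
    strangeValue₂ ((v.1, -v.2) - e • v) ^ 2 ≠ 16 := by
  decide +kernel

/-! ### Branches of a Clifford circuit on two Strange states -/

/-- The branch `l` of a two-qutrit vector. -/
def branch (x : Lbl × Lbl → ℂ) (l : Lbl) : Ket := fun i => x (i, l)

theorem twoCopyOutput_ketS (C : Op₂) (k : Lbl) :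
    twoCopyOutput C ketS k = branch (C *ᵥ strange₂) k := rfl

theorem dotProduct_kronecker_clock (x : Lbl × Lbl → ℂ) (D : Op) (c : Lbl) :
    star x ⬝ᵥ (D ⊗ₖ weyl 0 c) *ᵥ x =
      ∑ l, chi (c * l) * (star (branch x l) ⬝ᵥ D *ᵥ branch x l) := by
  simp only [dotProduct, Matrix.mulVec, Matrix.kroneckerMap_apply, Fintype.sum_prod_type,
    Pi.star_apply, weyl_apply, add_zero, branch, mul_ite, ite_mul, mul_zero, zero_mul,
    Finset.sum_ite_eq, Finset.mem_univ, if_true]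
  rw [Finset.sum_comm]
  refine Finset.sum_congr rfl fun l _ => ?_
  rw [Finset.mul_sum]
  refine Finset.sum_congr rfl fun i _ => ?_
  rw [Finset.mul_sum, Finset.mul_sum, Finset.mul_sum]
  refine Finset.sum_congr rfl fun j _ => ?_
  ring

/-- Fourier inversion: the projector on ancilla outcome `k` is one third of the sum of `ω ^ (-k c) Z
^ c`. -/
theorem sum_chi_mul_dotProduct_kronecker_clock (x : Lbl × Lbl → ℂ) (D : Op) (k : Lbl) :
    ∑ c, chi (-(k * c)) * (star x ⬝ᵥ (D ⊗ₖ weyl 0 c) *ᵥ x) =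
      3 * (star (branch x k) ⬝ᵥ D *ᵥ branch x k) := by
  simp only [dotProduct_kronecker_clock, Finset.mul_sum]
  rw [Finset.sum_comm, Finset.sum_eq_single k]
  · rw [← Finset.sum_congr rfl fun c _ => mul_assoc _ _ _, ← Finset.sum_mul]
    congr 1
    have h : ∀ c, chi (-(k * c)) * chi (c * k) = 1 := fun c => by
      rw [mul_comm c k, chi_neg_mul_self]
    simp [h]
  · intro l _ hl
    have h : ∀ c, chi (-(k * c)) * (chi (c * l) * (star (branch x l) ⬝ᵥ D *ᵥ branch x l)) =
        chi ((l - k) * c) * (star (branch x l) ⬝ᵥ D *ᵥ branch x l) := fun c => by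
      rw [← mul_assoc, ← chi_add]; congr 2; ring
    rw [Finset.sum_congr rfl fun c _ => h c, ← Finset.sum_mul, sum_chi_mul,
      if_neg (sub_ne_zero.2 hl), zero_mul]
  · simp

theorem dotProduct_conj (C M : Op₂) (x : Lbl × Lbl → ℂ) :
    star x ⬝ᵥ (Cᴴ * M * C) *ᵥ x = star (C *ᵥ x) ⬝ᵥ M *ᵥ (C *ᵥ x) := by
  rw [Matrix.star_mulVec, ← Matrix.dotProduct_mulVec, Matrix.mulVec_mulVec, Matrix.mulVec_mulVec,
    Matrix.mul_assoc]

section Branch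

variable {C : Op₂} {q : Lbl} {v : Pt}

theorem conj_mul_conj (hC : C ∈ clifford₂) (M N : Op₂) :
    (Cᴴ * M * C) * (Cᴴ * N * C) = Cᴴ * (M * N) * C := by
  calc (Cᴴ * M * C) * (Cᴴ * N * C) = Cᴴ * M * (C * Cᴴ) * N * C := by
        simp only [Matrix.mul_assoc]
    _ = Cᴴ * (M * N) * C := by
        rw [mul_conjTranspose_self_of_mem hC, mul_one]; simp only [Matrix.mul_assoc]

theorem conj_clock (hC : C ∈ clifford₂)
    (hQ : Cᴴ * ((1 : Op) ⊗ₖ weyl 0 1) * C = chi q • sweyl₂ v) (c : Lbl) :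
    Cᴴ * ((1 : Op) ⊗ₖ weyl 0 c) * C = chi (q * c) • sweyl₂ (c • v) := by
  have hc : c = 0 ∨ c = 1 ∨ c = 2 := by revert c; decide
  rcases hc with rfl | rfl | rfl
  · rw [weyl_zero, Matrix.one_kronecker_one, mul_one, conjTranspose_mul_self_of_mem hC]
    simp [sweyl₂_zero]
  · simpa using hQ
  · have h2 : (1 : Op) ⊗ₖ weyl 0 2 = ((1 : Op) ⊗ₖ weyl 0 1) * ((1 : Op) ⊗ₖ weyl 0 1) := by
      rw [← Matrix.mul_kronecker_mul, weyl_mul]; simp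
    rw [h2, ← conj_mul_conj hC, hQ, Matrix.smul_mul, Matrix.mul_smul, sweyl₂_mul, sympl_self,
      chi_zero, one_smul, smul_smul, ← chi_add, ← two_smul Lbl v, ← mul_two]

/-- The expectation value of a data operator `D` in a branch, when `D` is pulled back to a Weyl
operator. -/
theorem dotProduct_branch (hC : C ∈ clifford₂)
    (hQ : Cᴴ * ((1 : Op) ⊗ₖ weyl 0 1) * C = chi q • sweyl₂ v) {D : Op} {s : Lbl} {u : Pt}
    (hD : Cᴴ * (D ⊗ₖ (1 : Op)) * C = chi s • sweyl₂ u) (k : Lbl) (huv : sympl u v = 0) :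
    12 * (star (twoCopyOutput C ketS k) ⬝ᵥ D *ᵥ twoCopyOutput C ketS k) =
      chi s * projectedValue (q - k) v u := by
  -- The factor `12` is `3` from Fourier inversion times `4` from the normalization of
  -- `strangeValue₂`.
  have h := sum_chi_mul_dotProduct_kronecker_clock (C *ᵥ strange₂) D k
  have hc : ∀ c, star (C *ᵥ strange₂) ⬝ᵥ (D ⊗ₖ weyl 0 c) *ᵥ (C *ᵥ strange₂) =
      chi s * chi (q * c) * (strangeValue₂ (u + c • v) / 4) := by
    intro c
    have h1 : D ⊗ₖ weyl 0 c = (D ⊗ₖ (1 : Op)) * ((1 : Op) ⊗ₖ weyl 0 c) := by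
      rw [← Matrix.mul_kronecker_mul, mul_one, one_mul]
    rw [← dotProduct_conj, h1, ← conj_mul_conj hC, hD, conj_clock hC hQ, Matrix.smul_mul,
      Matrix.mul_smul, sweyl₂_mul, sympl_smul_right, huv, mul_zero, chi_zero, one_smul, smul_smul,
      Matrix.smul_mulVec, dotProduct_smul, dotProduct_sweyl₂_strange₂, smul_eq_mul]
  rw [twoCopyOutput_ketS, projectedValue, Finset.mul_sum]
  rw [Finset.sum_congr rfl fun c _ => by rw [hc c]] at h
  calc _ = 4 * (3 * (star (branch (C *ᵥ strange₂) k) ⬝ᵥ D *ᵥ branch (C *ᵥ strange₂) k)) := by ring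
    _ = _ := by
      rw [← h, Finset.mul_sum]
      refine Finset.sum_congr rfl fun c _ => ?_
      have h2 : (q - k) * c = -(k * c) + q * c := by ring
      rw [h2, chi_add]; ring

theorem sympl_eq_zero_of_conj (hC : C ∈ clifford₂)
    (hQ : Cᴴ * ((1 : Op) ⊗ₖ weyl 0 1) * C = chi q • sweyl₂ v) {D : Op} {s : Lbl} {u : Pt}
    (hD : Cᴴ * (D ⊗ₖ (1 : Op)) * C = chi s • sweyl₂ u) : sympl u v = 0 := by
  apply sympl_eq_zero_of_commute
  have h : (chi s • sweyl₂ u) * (chi q • sweyl₂ v) = (chi q • sweyl₂ v) * (chi s • sweyl₂ u) := by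
    rw [← hQ, ← hD, conj_mul_conj hC, conj_mul_conj hC, ← Matrix.mul_kronecker_mul,
      ← Matrix.mul_kronecker_mul]
    simp
  rw [smul_mul_smul_comm, smul_mul_smul_comm, mul_comm (chi q)] at h
  exact smul_right_injective _ (mul_ne_zero (chi_ne_zero s) (chi_ne_zero q)) h

end Branch

/-! ### Eigenvectors of Weyl operators and phase states -/

open scoped ComplexOrder in
theorem star_dotProduct_self_eq_zero {x : Ket} (h : star x ⬝ᵥ x = 0) : x = 0 :=
  dotProduct_star_self_eq_zero.1 h

/-- A unit-modulus expectation value of a unitary operator is an eigenvalue. -/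
theorem mulVec_eq_smul_of_dotProduct_eq {D : Op} (hD : Dᴴ * D = 1) {x : Ket} {l : ℂ}
    (hl : ‖l‖ = 1) (h : star x ⬝ᵥ D *ᵥ x = l * (star x ⬝ᵥ x)) : D *ᵥ x = l • x := by
  rw [← sub_eq_zero]
  -- Equality in Cauchy–Schwarz: the squared norm of `D x - l x` expands to zero.
  apply star_dotProduct_self_eq_zero
  have hl' := mul_star_of_norm_eq_one hl
  have h1 : star (D *ᵥ x) ⬝ᵥ D *ᵥ x = star x ⬝ᵥ x := by
    rw [Matrix.star_mulVec, ← Matrix.dotProduct_mulVec, Matrix.mulVec_mulVec, hD, Matrix.one_mulVec]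
  have h2 : star (D *ᵥ x) ⬝ᵥ x = star l * (star x ⬝ᵥ x) := by
    rw [Matrix.star_dotProduct, h, star_mul', ← Matrix.star_dotProduct]
  rw [star_sub, sub_dotProduct, dotProduct_sub, dotProduct_sub, h1, star_smul, smul_dotProduct,
    smul_dotProduct, dotProduct_smul, dotProduct_smul, h2, h]
  simp only [smul_eq_mul]
  linear_combination (-(star x ⬝ᵥ x)) * hl'

theorem weyl_conjTranspose_mul_self (a b : Lbl) : (weyl a b)ᴴ * weyl a b = 1 := by
  ext i j
  rw [Matrix.mul_apply, Finset.sum_eq_single (j + a)]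
  · rw [Matrix.conjTranspose_apply, weyl_apply, weyl_apply, if_pos rfl, Matrix.one_apply]
    by_cases h : i = j
    · subst h
      rw [if_pos rfl, if_pos rfl, star_chi, chi_neg_mul_self]
    · rw [if_neg (by simpa using fun h' => h h'.symm), if_neg h, star_zero, zero_mul]
  · intro k _ hk
    rw [weyl_apply a b k j, if_neg hk, mul_zero]
  · simp

theorem weyl_mulVec (a b j : Lbl) (x : Ket) : (weyl a b *ᵥ x) (j + a) = chi (b * j) * x j := by
  rw [Matrix.mulVec, dotProduct, Finset.sum_eq_single j]
  · rw [weyl_apply, if_pos rfl]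
  · intro k _ hk
    rw [weyl_apply, if_neg (by simpa using fun h => hk h.symm), zero_mul]
  · simp

theorem sweyl_conjTranspose_mul_self (p : Lbl × Lbl) : (sweyl p)ᴴ * sweyl p = 1 := by
  rw [sweyl, Matrix.conjTranspose_smul, smul_mul_smul_comm, weyl_conjTranspose_mul_self, mul_comm,
    mul_star_of_norm_eq_one (norm_chi _), one_smul]

theorem one_kronecker_weyl (c : Lbl) : (1 : Op) ⊗ₖ weyl 0 c = sweyl₂ (0, (0, c)) := by
  simp [sweyl₂, sweyl, weyl_zero]

/-- A Clifford unitary maps a Weyl operator commuting with the pull-back of the clock on the ancilla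
to a Weyl operator on the data times a power of the clock on the ancilla. -/
theorem exists_sweyl_kronecker_weyl {C : Op₂} (hC : C ∈ clifford₂) {q : Lbl} {u v : Pt}
    (hQ : Cᴴ * ((1 : Op) ⊗ₖ weyl 0 1) * C = chi q • sweyl₂ v) (huv : sympl u v = 0) :
    ∃ (s e : Lbl) (p : Lbl × Lbl), sweyl₂ u = chi s • (Cᴴ * (sweyl p ⊗ₖ weyl 0 e) * C) := by
  obtain ⟨s, m, hm⟩ := exists_sweyl₂_of_mem_pauli₂
    (conj_mem_of_mem_unitaryNormalizer hC (sweyl₂_mem_pauli₂ u))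
  have hu : sweyl₂ u = chi s • (Cᴴ * sweyl₂ m * C) := by
    calc sweyl₂ u = (Cᴴ * C) * sweyl₂ u * (Cᴴ * C) := by
          rw [conjTranspose_mul_self_of_mem hC, one_mul, mul_one]
      _ = Cᴴ * (C * sweyl₂ u * Cᴴ) * C := by simp only [Matrix.mul_assoc]
      _ = _ := by rw [hm, Matrix.mul_smul, Matrix.smul_mul]
  -- The image commutes with the ancilla clock, so it has no shift on the ancilla.
  have hz : m.2.1 = 0 := by
    have hcomm : sweyl₂ m * sweyl₂ (0, (0, 1)) = sweyl₂ (0, (0, 1)) * sweyl₂ m := by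
      rw [← one_kronecker_weyl]
      apply smul_right_injective Op₂ (chi_ne_zero s)
      have hcan : ∀ A : Op₂, C * (Cᴴ * A * C) * Cᴴ = A := fun A => by
        calc C * (Cᴴ * A * C) * Cᴴ = (C * Cᴴ) * A * (C * Cᴴ) := by simp only [Matrix.mul_assoc]
          _ = A := by rw [mul_conjTranspose_self_of_mem hC, one_mul, mul_one]
      have h1 : Cᴴ * (chi s • (sweyl₂ m * ((1 : Op) ⊗ₖ weyl 0 1))) * C =
          Cᴴ * (chi s • (((1 : Op) ⊗ₖ weyl 0 1) * sweyl₂ m)) * C := by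
        rw [Matrix.mul_smul, Matrix.smul_mul, Matrix.mul_smul, Matrix.smul_mul, ← conj_mul_conj hC,
          ← conj_mul_conj hC, hQ, ← Matrix.smul_mul, ← hu, ← Matrix.mul_smul, ← hu, Matrix.mul_smul,
          Matrix.smul_mul, sweyl₂_mul, sweyl₂_mul, sympl_swap u v, huv, neg_zero, add_comm]
      have h2 := congrArg (fun A => C * A * Cᴴ) h1
      simpa only [hcan] using h2
    have h := sympl_eq_zero_of_commute hcomm
    simpa [sympl] using h
  refine ⟨s, m.2.2, m.1, ?_⟩
  have hm2 : sweyl m.2 = weyl 0 m.2.2 := by rw [sweyl, hz]; simp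
  rw [hu, sweyl₂, hm2]

theorem star_dotProduct_self_ne_zero_of_isPhaseState {φ : Ket} (hφ : IsPhaseState φ) {c : ℂ}
    (hc : c ≠ 0) : star (c • φ) ⬝ᵥ (c • φ) ≠ 0 := by
  intro h
  have h1 := congrFun (star_dotProduct_self_eq_zero h) 0
  exact mul_ne_zero hc (hφ.ne_zero 0) h1

theorem dotProduct_clock_of_isPhaseState {φ : Ket} (hφ : IsPhaseState φ) (c : ℂ) :
    star (c • φ) ⬝ᵥ weyl 0 1 *ᵥ (c • φ) = 0 := by
  have h1 : ∀ i, φ i * star (φ i) = 1 / 3 := by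
    intro i
    have h2 := mul_star_of_norm_eq_one (hφ.norm_sqrt_three_mul i)
    rw [star_mul', Complex.star_def, Complex.conj_ofReal] at h2
    rw [Complex.star_def]
    linear_combination h2 / 3 - φ i * (starRingEnd ℂ) (φ i) / 3 * sqrt_three_sq
  have h3 : ∀ i, star (c • φ) i * (weyl 0 1 *ᵥ (c • φ)) i = c * star c / 3 * chi (1 * i) := by
    intro i
    have h4 := weyl_mulVec 0 1 i (c • φ)
    rw [add_zero] at h4
    rw [h4, Pi.star_apply, Pi.smul_apply, smul_eq_mul, star_mul']
    linear_combination c * star c * chi (1 * i) * h1 i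
  rw [dotProduct, Finset.sum_congr rfl fun i _ => h3 i, ← Finset.mul_sum, sum_chi_mul,
    if_neg one_ne_zero, mul_zero]

/-- An eigenvector of `weyl a b` without zero entries has equal cubes of entries, unless `weyl a b`
is the identity. -/
theorem cube_eq_of_weyl_mulVec_eq {a b r : Lbl} {x : Ket} (hx : ∀ j, x j ≠ 0)
    (h : weyl a b *ᵥ x = chi r • x) : (a, b) = 0 ∨ ∀ i j, x i ^ 3 = x j ^ 3 := by
  have h1 : ∀ j, chi (b * j) * x j = chi r * x (j + a) := by
    intro j; rw [← weyl_mulVec, h]; rfl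
  -- Without a shift, the operator is diagonal and nonvanishing entries force it to be scalar. With
  -- a shift, the eigenvalue equation relates cubes along an orbit that covers all labels.
  by_cases ha : a = 0
  · left
    subst ha
    have h2 : ∀ j, b * j = r := by
      intro j
      have h3 := h1 j
      rw [add_zero] at h3
      have h4 := chi_sub_mul (b * j) r
      rw [mul_right_cancel₀ (hx j) h3] at h4
      exact sub_eq_zero.1 ((chi_eq_one_iff _).1 (mul_right_cancel₀ (chi_ne_zero r)
        (h4.trans (one_mul _).symm)))
    have h5 := (h2 1).trans (h2 0).symm
    rw [mul_one, mul_zero] at h5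
    rw [h5]; rfl
  · right
    have h2 : ∀ j, x (j + a) ^ 3 = x j ^ 3 := by
      intro j
      have h3 := congrArg (· ^ 3) (h1 j)
      simp only [mul_pow, chi_cube, one_mul] at h3
      exact h3.symm
    have h3 : ∀ j, x j ^ 3 = x 0 ^ 3 := by
      intro j
      have h4 : ∀ a j : Lbl, a ≠ 0 → j = 0 ∨ j = 0 + a ∨ j = 0 + a + a := by decide
      rcases h4 a j ha with rfl | rfl | rfl
      · rfl
      · rw [h2]
      · rw [h2, h2]
    exact fun i j => (h3 i).trans (h3 j).symm

/-- A phase state obtained from two Strange states by a Clifford circuit has amplitudes with equal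
cubes. -/
theorem cube_eq_of_twoCopyOutput_ketS {C : Op₂} (hC : C ∈ clifford₂) {k : Lbl} {c : ℂ} {φ : Ket}
    (hc : c ≠ 0) (hφ : IsPhaseState φ) (h : twoCopyOutput C ketS k = c • φ) (i j : Lbl) :
    φ i ^ 3 = φ j ^ 3 := by
  obtain ⟨q, v, hQ⟩ := exists_sweyl₂_of_mem_pauli₂
    (conj_symm_mem_of_mem_unitaryNormalizer hC (kronecker_weyl_mem_pauli₂ 0 0 0 1))
  obtain ⟨s, u, hD⟩ := exists_sweyl₂_of_mem_pauli₂
    (conj_symm_mem_of_mem_unitaryNormalizer hC (kronecker_weyl_mem_pauli₂ 0 1 0 0))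
  rw [weyl_zero] at hQ hD
  have h1 : Cᴴ * ((1 : Op) ⊗ₖ (1 : Op)) * C = chi 0 • sweyl₂ 0 := by
    rw [Matrix.one_kronecker_one, mul_one, conjTranspose_mul_self_of_mem hC, chi_zero, one_smul,
      sweyl₂_zero]
  have hN := dotProduct_branch hC hQ h1 k (sympl_eq_zero_of_conj hC hQ h1)
  have huv := sympl_eq_zero_of_conj hC hQ hD
  have hZ := dotProduct_branch hC hQ hD k huv
  rw [Matrix.one_mulVec, chi_zero, one_mul] at hN
  -- The vanishing clock expectation of a phase state becomes a vanishing projected value at `u`.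
  rw [h, dotProduct_clock_of_isPhaseState hφ, mul_zero, eq_comm, mul_eq_zero] at hZ
  have hN0 : projectedValue (q - k) v 0 ≠ 0 := by
    rw [← hN, h]
    exact mul_ne_zero (by norm_num) (star_dotProduct_self_ne_zero_of_isPhaseState hφ hc)
  obtain ⟨hw, hv1, hv2⟩ := (projectedValue_zero_eq_zero_or huv
    (hZ.resolve_left (chi_ne_zero s))).resolve_left hN0
  have hyv : sympl (v.1, -v.2) v = 0 := by
    simp only [sympl, Prod.fst_neg, Prod.snd_neg]; ring
  obtain ⟨t, e, p, hp⟩ := exists_sweyl_kronecker_weyl hC hQ hyv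
  -- Removing the ancilla clock factor moves the point by `-e • v`, which changes the projected
  -- value only by a phase.
  have hDp : Cᴴ * (sweyl p ⊗ₖ (1 : Op)) * C =
      chi (-t + q * -e) • sweyl₂ ((v.1, -v.2) - e • v) := by
    have h2 : sweyl p ⊗ₖ (1 : Op) = (sweyl p ⊗ₖ weyl 0 e) * ((1 : Op) ⊗ₖ weyl 0 (-e)) := by
      rw [← Matrix.mul_kronecker_mul, mul_one, weyl_mul]; simp [weyl_zero]
    have h3 : Cᴴ * (sweyl p ⊗ₖ weyl 0 e) * C = chi (-t) • sweyl₂ (v.1, -v.2) := by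
      rw [hp, smul_smul, chi_neg_mul_self, one_smul]
    rw [h2, ← conj_mul_conj hC, h3, conj_clock hC hQ, smul_mul_smul_comm, sweyl₂_mul,
      sympl_smul_right, hyv, mul_zero, chi_zero, one_smul, ← chi_add, neg_smul, ← sub_eq_add_neg]
  have hE := dotProduct_branch hC hQ hDp k (sympl_eq_zero_of_conj hC hQ hDp)
  -- The projected values at `0` and at `(v.1, -v.2)` are both `3`, so the expectation of `sweyl p`
  -- equals the squared norm up to a phase.
  obtain ⟨h3, h3'⟩ := projectedValue_of_ne_zero hw hv1 hv2
  rw [projectedValue_sub_smul, h3', ← mul_assoc, ← chi_add, ← h3, ← hN] at hE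
  have hE' : star (c • φ) ⬝ᵥ sweyl p *ᵥ (c • φ) =
      chi (-t + q * -e + (q - k) * e) * (star (c • φ) ⬝ᵥ (c • φ)) := by
    rw [h] at hE
    linear_combination hE / 12
  have heig := mulVec_eq_smul_of_dotProduct_eq (sweyl_conjTranspose_mul_self p) (norm_chi _) hE'
  have heig' : weyl p.1 p.2 *ᵥ (c • φ) =
      chi (p.1 * p.2 + (-t + q * -e + (q - k) * e)) • (c • φ) := by
    rw [chi_add, ← smul_smul, ← heig, weyl_eq_smul_sweyl, Matrix.smul_mulVec]
  rcases cube_eq_of_weyl_mulVec_eq (fun j => mul_ne_zero hc (hφ.ne_zero j)) heig' with h0 | h0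
  -- If `p = 0`, the identity would be a phase times the Weyl operator at `(v.1, -v.2) - e • v`;
  -- comparing expectations in two Strange states contradicts that this point has no value `±4`.
  · exfalso
    have hp0 : p = 0 := h0
    have h4 : sweyl (0 : Lbl × Lbl) = 1 := by simp [sweyl, weyl_zero]
    rw [hp0, h4, Matrix.one_kronecker_one, mul_one, conjTranspose_mul_self_of_mem hC,
      ← sweyl₂_zero] at hDp
    have h5 := congrArg (fun A => star strange₂ ⬝ᵥ A *ᵥ strange₂) hDp
    simp only [Matrix.smul_mulVec, dotProduct_smul, dotProduct_sweyl₂_strange₂] at h5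
    have h6 := congrArg norm h5
    have h7 : strangeValue₂ 0 = 4 := by decide
    rw [smul_eq_mul, norm_mul, norm_chi, one_mul, h7, norm_div, norm_div, Complex.norm_intCast,
      Complex.norm_intCast] at h6
    apply strangeValue₂_sub_smul_sq_ne v e hv1 hv2
    have h8 : |(strangeValue₂ ((v.1, -v.2) - e • v) : ℝ)| = 4 := by
      norm_num at h6; linarith
    have h9 := congrArg (· ^ 2) h8
    simp only [sq_abs] at h9
    norm_num at h9
    exact_mod_cast h9
  · have h10 := h0 i j
    simp only [mul_pow] at h10
    exact mul_left_cancel₀ (pow_ne_zero 3 hc) h10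

end Qutrit

end

open Qutrit

theorem theorem5 :
    -- the Hadamard eigenstate
    (circuitH3 ∈ clifford₂ ∧
      ∃ (c : ℂ) (φ : Ket), IsPhaseState φ ∧
        φ = (fun j => ![1, Complex.I, Complex.exp (Real.pi / 3 * Complex.I)] j
          / (Real.sqrt 3 : ℂ)) ∧
        twoCopyOutput circuitH3 ketH3 1 = c • φ ∧
        ‖c‖ ^ 2 = 3 / 8 ∧ successProb circuitH3 ketH3 1 = 3 / 8 ∧
        injectedGate φ 0 =
          Matrix.diagonal ![1, Complex.I, Complex.exp (Real.pi / 3 * Complex.I)] ∧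
        ∀ m, injectedGate φ m ∉ clifford₁) ∧
    -- the Norrell state
    (circuitN ∈ clifford₂ ∧
      ∃ (c : ℂ) (φ : Ket), IsPhaseState φ ∧
        φ = (fun j => ![1, -1, -1] j / (Real.sqrt 3 : ℂ)) ∧
        twoCopyOutput circuitN ketN 0 = c • φ ∧
        ‖c‖ ^ 2 = 1 / 4 ∧ successProb circuitN ketN 0 = 1 / 4 ∧
        injectedGate φ 0 = Matrix.diagonal ![1, -1, -1] ∧
        ∀ m, injectedGate φ m ∉ clifford₁) ∧
    -- the Strange state
    (∀ C ∈ clifford₂, ∀ (k : Lbl) (c : ℂ) (φ : Ket), c ≠ 0 → IsPhaseState φ →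
      twoCopyOutput C ketS k = c • φ → ∀ m, injectedGate φ m ∈ clifford₁) := by
  refine ⟨⟨circuitH3_mem_clifford₂, _, phaseH3, isPhaseState_phaseH3, rfl,
      twoCopyOutput_circuitH3, norm_sq_coeffH3, ?_, injectedGate_zero _,
      injectedGate_phaseH3_notMem⟩,
    ⟨circuitN_mem_clifford₂, _, phaseN, isPhaseState_phaseN, rfl, twoCopyOutput_circuitN,
      by norm_num, ?_, injectedGate_zero _, injectedGate_phaseN_notMem⟩,
    fun C hC k c φ hc hφ h m => (injectedGate_mem_clifford₁_iff hφ m).2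
      (cube_eq_of_twoCopyOutput_ketS hC hc hφ h)⟩
  · rw [successProb_of_eq_smul isPhaseState_phaseH3 twoCopyOutput_circuitH3, norm_sq_coeffH3]
  · rw [successProb_of_eq_smul isPhaseState_phaseN twoCopyOutput_circuitN]
    norm_num
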